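/- **Setting.** The input of the (three-dimensional) GIGAQBX FMM consists of $N_S$ sources, $N_C$ QBX centers $c$ with expansion radii $r_c>0$, and $N_T$ targets, each assigned to a QBX center; $N=N_S+N_C+N_T$. A root cube contains all these particles and all expansion balls $\overline{B_2}(r_c,c)$. Boxes are the dyadic subcubes of the root; $|b|$ is half the side length of $b$, and, for a target confinement factor $0<t_f<2$, $\mathsf{TCR}(b)$ is the closed Euclidean ball of radius $\sqrt3|b|(1+t_f)$ around the center of $b$. Boxes are adjacent if their closed cubes meet. The $2$-colleagues of $b$ are the boxes of the same level contained in the concentric cube of radius $5|b|$. *Tree build.* Starting with the root, which owns all particles, one repeatedly subdivides, in rounds, all boxes owning more than $n_{\max}$ particles. On subdivision of $b$ each particle moves to the child containing its position, except that a QBX center whose expansion ball is not contained in the $\mathsf{TCR}$ of that child stays in $b$; empty childless boxes are pruned. The build stops after a round that produces only empty children (this is assumed to happen). A round costs, for each box it subdivides or attempts to subdivide, one operation per child and one per particle owned by the box. An *octree* below is the result of the tree build or of further subdivision of it; $N_B$ is its number of boxes (after pruning) and $L$ its number of levels (a single root counts as one level). It is *level-restricted* if adjacent leaves of the octree before pruning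 (leaves that fill the root cube) differ by at most one level. Further, $$M_C=\frac1{N_C}\sum_{c}\#\{\text{sources in }\overline{B_\infty}(4\sqrt3\,r_c/t_f,\,c)\}.$$ *Interaction lists.* Target boxes own a target or a QBX center, source boxes own a source, leaves have no children. Write $d\prec\mathsf{TCR}(b)$ if the Euclidean distance from the center of $d$ to $\mathsf{TCR}(b)$ is at least $3|d|$, and $\mathsf{TCR}(b)\prec d$ if the $\ell^\infty$ distance from the center of $b$ to $d$ is at least $3|b|(1+t_f)$. For a target box $b$: List 1 contains the leaves among $b$, its descendants and the boxes adjacent to $b$; List 3 contains the descendants $d$ of $2$-colleagues of $b$ that are not adjacent to $b$ while all ancestors of $d$ that are descendants of $2$-colleagues of $b$ are adjacent to $b$; among the boxes of List 3 and their descendants, List 3 close contains the leaves $d\not\prec\mathsf{TCR}(b)$, and List 3 far the maximal boxes $d\prec\mathsf{TCR}(b)$. For a target box or ancestor of one $b$: List 2 contains the children of $2$-colleagues of the parent of $b$ that are not $2$-colleagues of $b$; List 4 contains the source boxes $d$ not adjacent to $b$ that are either $2$-colleagues of $b$, or $2$-colleagues of an ancestor of $b$ and adjacent to the parent of $b$;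 List 4 close contains the boxes $d$ of List 4 of $b$ or of an ancestor of $b$ with $\mathsf{TCR}(b)\not\prec d$; List 4 far contains the boxes $d$ with $\mathsf{TCR}(b)\prec d$ from List 4 of $b$ or List 4 close of its parent. *Evaluation cost.* With FMM order $p$ and QBX order $q\le p$, let $n_S(b),n_C(b)$ be the numbers of sources and centers owned by $b$. The modeled cost of the evaluation stage is the sum of: $p^2$ per source and $p^3$ per (parent, child) pair (forming and shifting multipoles); $n_S(d)n_C(b)q^2$ for each pair ($b$, $d$ in List 1, List 3 close or List 4 close of $b$); $p^3$ for each pair ($b$, $d$ in List 2); $\min\bigl(n_C(b)p^3,\ n\,n_C(b)q^2\bigr)$ for each pair ($b$, $d$ in List 3 far), $n$ being the number of sources in the leaves among $d$ and its descendants (a List 3 far interaction is replaced by direct ones whenever this is cheaper); $n_S(d)p^2$ for each pair ($b$, $d$ in List 4 far); $p^3$ per (parent, child) pair (shifting locals); $p^3$ per QBX center; $q^2$ per target. **Theorem.** (a) The modeled cost of the tree build is $O(NL)$, with an absolute constant. (b) Let $0<\varepsilon<1$, fix $n_{\max}$ and $A$, and assume $p\le A|\log\varepsilon|$. The modeled cost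 of the evaluation stage is $$O\bigl((N_C+N_S+N_B)|\log\varepsilon|^3+(N_CM_C+NL)|\log\varepsilon|^2+N_T|\log\varepsilon|^2\bigr),$$ with a constant depending only on $n_{\max}$ and $A$. If the octree is level-restricted and $t_f<\sqrt3-1$, it is $$O\bigl((N_C+N_S+N_B)|\log\varepsilon|^3+N_CM_C|\log\varepsilon|^2+N_T|\log\varepsilon|^2\bigr),$$ with a constant depending only on $n_{\max}$, $A$ and $t_f$. If moreover $N_B\le KN$ and $M_C\le M$, it is at most $C\,N$, where $C$ depends only on $n_{\max},A,t_f,K,M,\varepsilon$. -/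

import Mathlib

namespace Gigaqbx

noncomputable section

open scoped Classical

/-- Points of three-dimensional space, with the Euclidean norm. -/
abbrev Pt : Type := EuclideanSpace ℝ (Fin 3)

/-- The closed cube (closed ball of the maximum norm) of radius `r` around `c`. -/
def cube (r : ℝ) (c : Pt) : Set Pt := {x | ∀ i, |x i - c i| ≤ r}

/-! ### Particles -/

/-- The input of the algorithm: sources, QBX centers with their expansion radii, and targets, each
target being assigned to a QBX center, together with a root box that contains all particles and
all expansion balls. Distinct indices may carry the same point. -/
structure Input where
  numS : ℕ
  numC : ℕ
  numT : ℕ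
  src : Fin numS → Pt
  ctr : Fin numC → Pt
  rad : Fin numC → ℝ
  tgt : Fin numT → Pt
  assoc : Fin numT → Fin numC
  rootCtr : Pt
  rootRad : ℝ
  rad_pos : ∀ c, 0 < rad c
  rootRad_pos : 0 < rootRad
  src_mem : ∀ s, src s ∈ cube rootRad rootCtr
  tgt_mem : ∀ t, tgt t ∈ cube rootRad rootCtr
  ball_subset : ∀ c, Metric.closedBall (ctr c) (rad c) ⊆ cube rootRad rootCtr

/-- A particle is a source, a QBX center or a target. -/
abbrev Input.Particle (P : Input) : Type := Fin P.numS ⊕ Fin P.numC ⊕ Fin P.numT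

/-- The particle that is the source `s`. -/
abbrev Input.ofSrc (P : Input) (s : Fin P.numS) : P.Particle := Sum.inl s

/-- The particle that is the QBX center `c`. -/
abbrev Input.ofCtr (P : Input) (c : Fin P.numC) : P.Particle := Sum.inr (Sum.inl c)

/-- The particle that is the target `t`. -/
abbrev Input.ofTgt (P : Input) (t : Fin P.numT) : P.Particle := Sum.inr (Sum.inr t)

/-- The position of a particle. -/
def Input.pos (P : Input) : P.Particle → Pt
  | Sum.inl s => P.src s
  | Sum.inr (Sum.inl c) => P.ctr c
  | Sum.inr (Sum.inr t) => P.tgt t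

/-- The number `N` of particles. -/
def Input.numParticles (P : Input) : ℕ := P.numS + P.numC + P.numT

/-- `M_C`: the average, over the QBX centers `c`, of the number of sources in the closed cube of
radius `4 √3 r_c / t_f` around `c`. -/
def Input.avgNear (P : Input) (tf : ℝ) : ℝ :=
  (∑ c : Fin P.numC,
    ((Finset.univ.filter fun s : Fin P.numS =>
      P.src s ∈ cube (4 * √3 * P.rad c / tf) (P.ctr c)).card : ℝ)) / P.numC

/-! ### Boxes -/

/-- A cell of the dyadic grid: at level `k` the root box is cut into `2 ^ k` slabs along each axis,
and `idx i` is the number of the slab along axis `i`. -/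
@[ext]
structure Box where
  level : ℕ
  idx : Fin 3 → ℕ

/-- The root box. -/
def Box.root : Box := ⟨0, fun _ => 0⟩

/-- The eight children of a box are indexed by octants. -/
def Box.child (b : Box) (o : Fin 3 → Bool) : Box :=
  ⟨b.level + 1, fun i => 2 * b.idx i + (o i).toNat⟩

/-- The parent of a box that is not the root. -/
def Box.parent (b : Box) : Box := ⟨b.level - 1, fun i => b.idx i / 2⟩

/-- `a.IsAncestor b`: `a` is a (strict) ancestor of `b`, and `b` a (strict) descendant of `a`. -/
def Box.IsAncestor (a b : Box) : Prop :=
  a.level < b.level ∧ ∀ i, a.idx i = b.idx i / 2 ^ (b.level - a.level)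

/-- The radius `|b|`, half of the side length. -/
def Input.boxRad (P : Input) (b : Box) : ℝ := P.rootRad / 2 ^ b.level

/-- The center of a box. -/
def Input.boxCtr (P : Input) (b : Box) : Pt :=
  WithLp.toLp 2 fun i => P.rootCtr i - P.rootRad + (2 * (b.idx i : ℝ) + 1) * P.boxRad b

/-- The closed cube occupied by a box. -/
def Input.region (P : Input) (b : Box) : Set Pt := cube (P.boxRad b) (P.boxCtr b)

/-- The `k`-near neighborhood of a box. -/
def Input.near (P : Input) (k : ℕ) (b : Box) : Set Pt :=
  cube (P.boxRad b * (1 + 2 * k)) (P.boxCtr b)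

/-- The target confinement region of a box. -/
def Input.TCR (P : Input) (tf : ℝ) (b : Box) : Set Pt :=
  Metric.closedBall (P.boxCtr b) (√3 * P.boxRad b * (1 + tf))

/-- Two boxes are adjacent if they touch or overlap. -/
def Input.Adjacent (P : Input) (a b : Box) : Prop := (P.region a ∩ P.region b).Nonempty

/-- `d` is a `k`-colleague of `b`. -/
def Input.Colleague (P : Input) (k : ℕ) (d b : Box) : Prop :=
  d.level = b.level ∧ P.region d ⊆ P.near k b

/-- `a` and `b` are `k`-well-separated. -/
def Input.WellSep (P : Input) (k : ℕ) (a b : Box) : Prop :=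
  a.level = b.level ∧ ¬ P.Colleague k a b

/-- `a ≺ TCR(b)`: the Euclidean distance from the center of `a` to `TCR(b)` is at least `3|a|`. -/
def Input.SepFromTCR (P : Input) (tf : ℝ) (a b : Box) : Prop :=
  ∀ y ∈ P.TCR tf b, 3 * P.boxRad a ≤ dist (P.boxCtr a) y

/-- `TCR(a) ≺ b`: the maximum-norm distance from the center of `a` to the box `b` is at least
`3|a|(1 + t_f)`. -/
def Input.TCRSepFrom (P : Input) (tf : ℝ) (a b : Box) : Prop :=
  ∀ y ∈ P.region b, ∃ i, 3 * P.boxRad a * (1 + tf) ≤ |P.boxCtr a i - y i|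

/-! ### Placement of particles

An octree is given by the finite set `R` of its subdivided boxes. -/

/-- The child of `b` into which the position of the particle `x` falls; a point on a dividing plane
goes to the upper side. -/
def Input.childAt (P : Input) (b : Box) (x : P.Particle) : Box :=
  b.child fun i => decide (P.boxCtr b i ≤ P.pos x i)

/-- The target confinement rule: a QBX center may be placed in `b` only if its expansion ball lies
in the target confinement region of `b`; there is no restriction on other particles. -/
def Input.Fits (P : Input) (tf : ℝ) (b : Box) : P.Particle → Prop
  | Sum.inr (Sum.inl c) => Metric.closedBall (P.ctr c) (P.rad c) ⊆ P.TCR tf b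
  | _ => True

/-- The particle `x` can be moved from `b` to the child of `b` that contains its position. -/
def Input.CanDescend (P : Input) (tf : ℝ) (b : Box) (x : P.Particle) : Prop :=
  P.Fits tf (P.childAt b x) x

/-- The particle `x`, starting at the root, is moved to `b` or passes through `b` when the boxes in
`R` are subdivided. -/
inductive Input.Reaches (P : Input) (tf : ℝ) (R : Finset Box) (x : P.Particle) : Box → Prop
  | root : Input.Reaches P tf R x Box.root
  | step (b : Box) : Input.Reaches P tf R x b → b ∈ R → P.CanDescend tf b x →
      Input.Reaches P tf R x (P.childAt b x)

/-- The box `b` owns the particle `x`: the particle has reached `b` and does not move further. -/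
def Input.Owns (P : Input) (tf : ℝ) (R : Finset Box) (b : Box) (x : P.Particle) : Prop :=
  P.Reaches tf R x b ∧ ¬ (b ∈ R ∧ P.CanDescend tf b x)

/-- The number of particles owned by `b`. -/
def Input.numOwned (P : Input) (tf : ℝ) (R : Finset Box) (b : Box) : ℕ :=
  (Finset.univ.filter fun x : P.Particle => P.Owns tf R b x).card

/-- The number of sources owned by `b`. -/
def Input.nS (P : Input) (tf : ℝ) (R : Finset Box) (b : Box) : ℕ :=
  (Finset.univ.filter fun s : Fin P.numS => P.Owns tf R b (P.ofSrc s)).card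

/-- The number of QBX centers owned by `b`. -/
def Input.nC (P : Input) (tf : ℝ) (R : Finset Box) (b : Box) : ℕ :=
  (Finset.univ.filter fun c : Fin P.numC => P.Owns tf R b (P.ofCtr c)).card

/-- All boxes produced by subdividing the boxes in `R`, before pruning. -/
def allBoxes (R : Finset Box) : Finset Box :=
  insert Box.root (R.biUnion fun b => Finset.univ.image fun o => b.child o)

/-- The boxes of the octree after pruning: the root, and the boxes that own a particle or have a
descendant that owns a particle. -/
def Input.boxes (P : Input) (tf : ℝ) (R : Finset Box) : Finset Box :=
  (allBoxes R).filter fun b => b = Box.root ∨ ∃ x : P.Particle, P.Reaches tf R x b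

/-- The number `N_B` of boxes. -/
def Input.numBoxes (P : Input) (tf : ℝ) (R : Finset Box) : ℕ := (P.boxes tf R).card

/-- The number `L` of levels; the tree that consists of the root alone has one level. -/
def Input.numLevels (P : Input) (tf : ℝ) (R : Finset Box) : ℕ :=
  (P.boxes tf R).sup Box.level + 1

/-- The children of `b` in the octree. -/
def Input.children (P : Input) (tf : ℝ) (R : Finset Box) (b : Box) : Finset Box :=
  (P.boxes tf R).filter fun d => ∃ o, d = b.child o

/-- `b` is a leaf box: it has no children in the octree. -/
def Input.IsLeaf (P : Input) (tf : ℝ) (R : Finset Box) (b : Box) : Prop :=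
  b ∈ P.boxes tf R ∧ P.children tf R b = ∅

/-! ### Stage 1: tree build -/

/-- The boxes that one round of the tree build attempts to subdivide: those which own more than
`n_max` particles. -/
def Input.overfull (P : Input) (tf : ℝ) (nmax : ℕ) (R : Finset Box) : Finset Box :=
  (P.boxes tf R).filter fun b => nmax < P.numOwned tf R b

/-- One round of the tree build. All overfull boxes are subdivided, except that a subdivision which
only produces empty (hence pruned) children has no effect. -/
def Input.buildRound (P : Input) (tf : ℝ) (nmax : ℕ) (R : Finset Box) : Finset Box :=
  R ∪ (P.overfull tf nmax R).filter fun b => ∃ x, P.Owns tf R b x ∧ P.CanDescend tf b x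

/-- The set of subdivided boxes after `k` rounds, starting from the root box alone. -/
def Input.buildState (P : Input) (tf : ℝ) (nmax : ℕ) : ℕ → Finset Box
  | 0 => ∅
  | k + 1 => P.buildRound tf nmax (Input.buildState P tf nmax k)

/-- Some round of the tree build produces only empty children. (This fails only if more than
`n_max` particles which can be moved arbitrarily far down sit at the same point.) -/
def Input.BuildTerminates (P : Input) (tf : ℝ) (nmax : ℕ) : Prop :=
  ∃ k, P.buildState tf nmax (k + 1) = P.buildState tf nmax k

/-- The number of rounds before the final one, which changes nothing. -/
def Input.lastRound (P : Input) (tf : ℝ) (nmax : ℕ) : ℕ :=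
  sInf {k | P.buildState tf nmax (k + 1) = P.buildState tf nmax k}

/-- The octree constructed by the tree build. -/
def Input.buildTree (P : Input) (tf : ℝ) (nmax : ℕ) : Finset Box :=
  P.buildState tf nmax (P.lastRound tf nmax)

/-- The modeled cost of a round: for every box that is subdivided, or unsuccessfully attempted,
one operation for each of its eight children and one for each of its particles. -/
def Input.roundCost (P : Input) (tf : ℝ) (nmax : ℕ) (R : Finset Box) : ℕ :=
  ∑ b ∈ P.overfull tf nmax R, (8 + P.numOwned tf R b)

/-- The modeled cost of the tree build, including its final round. -/
def Input.buildCost (P : Input) (tf : ℝ) (nmax : ℕ) : ℕ :=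
  ∑ k ∈ Finset.range (P.lastRound tf nmax + 1), P.roundCost tf nmax (P.buildState tf nmax k)

/-- `R` is the set of subdivided boxes of an octree in which the tree build has nothing left to
subdivide. These are the tree `buildTree` and the trees obtained by refining it further. -/
structure Input.IsOctree (P : Input) (tf : ℝ) (nmax : ℕ) (R : Finset Box) : Prop where
  sub_allBoxes : R ⊆ allBoxes R
  finished : P.buildRound tf nmax R = R

/-- The outcome of the tree build is such an octree. -/
theorem Input.isOctree_buildTree (P : Input) (tf : ℝ) (nmax : ℕ)
    (h : P.BuildTerminates tf nmax) : P.IsOctree tf nmax (P.buildTree tf nmax) := by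
  refine ⟨?_, Nat.sInf_mem h⟩
  have mono : ∀ {R S : Finset Box}, R ⊆ S → allBoxes R ⊆ allBoxes S := fun hRS =>
    Finset.insert_subset_insert _ (Finset.biUnion_subset_biUnion_of_subset_left _ hRS)
  have key : ∀ k, P.buildState tf nmax k ⊆ allBoxes (P.buildState tf nmax k) := by
    intro k
    induction k with
    | zero => exact Finset.empty_subset _
    | succ k ih =>
      refine Finset.union_subset (ih.trans (mono Finset.subset_union_left)) ?_
      refine ((Finset.filter_subset _ _).trans (Finset.filter_subset _ _)).trans ?_
      exact (Finset.filter_subset _ _).trans (mono Finset.subset_union_left)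
  exact key _

/-- The octree is level-restricted: adjacent leaves of the octree (before empty leaves are pruned,
so that the leaves fill the root box) differ by at most one level. -/
def Input.LevelRestricted (P : Input) (R : Finset Box) : Prop :=
  ∀ a ∈ allBoxes R \ R, ∀ b ∈ allBoxes R \ R, P.Adjacent a b → a.level ≤ b.level + 1

/-! ### Interaction lists -/

section Lists

variable (P : Input) (tf : ℝ) (R : Finset Box)

/-- A target box owns a target or a QBX center. -/
def Input.IsTargetBox (b : Box) : Prop :=
  b ∈ P.boxes tf R ∧
    ((∃ t, P.Owns tf R b (P.ofTgt t)) ∨ ∃ c, P.Owns tf R b (P.ofCtr c))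

/-- `b` is a target box or an ancestor of a target box. -/
def Input.IsTargetOrAnc (b : Box) : Prop :=
  b ∈ P.boxes tf R ∧ ∃ d, P.IsTargetBox tf R d ∧ (d = b ∨ b.IsAncestor d)

/-- A source box owns a source. -/
def Input.IsSourceBox (b : Box) : Prop :=
  b ∈ P.boxes tf R ∧ ∃ s, P.Owns tf R b (P.ofSrc s)

/-- `d` is a descendant of a `2`-colleague of `b`. -/
def Input.DescColleague (b d : Box) : Prop :=
  ∃ e ∈ P.boxes tf R, P.Colleague 2 e b ∧ e.IsAncestor d

/-- List 1. -/
def Input.list1 (b : Box) : Finset Box :=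
  (P.boxes tf R).filter fun d => P.IsTargetBox tf R b ∧ P.IsLeaf tf R d ∧
    (d = b ∨ b.IsAncestor d ∨ P.Adjacent d b)

/-- List 2. -/
def Input.list2 (b : Box) : Finset Box :=
  (P.boxes tf R).filter fun d => P.IsTargetOrAnc tf R b ∧ b ≠ Box.root ∧
    (∃ e ∈ P.boxes tf R, P.Colleague 2 e b.parent ∧ d ∈ P.children tf R e) ∧ P.WellSep 2 d b

/-- List 3. -/
def Input.list3 (b : Box) : Finset Box :=
  (P.boxes tf R).filter fun d => P.IsTargetBox tf R b ∧ P.DescColleague tf R b d ∧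
    ¬ P.Adjacent d b ∧
    ∀ w ∈ P.boxes tf R, w.IsAncestor d → P.DescColleague tf R b w → P.Adjacent w b

/-- The boxes of List 3 and their descendants. -/
def Input.list3Desc (b : Box) : Finset Box :=
  (P.boxes tf R).filter fun d => ∃ e ∈ P.list3 tf R b, d = e ∨ e.IsAncestor d

/-- List 3 close. -/
def Input.list3close (b : Box) : Finset Box :=
  (P.list3Desc tf R b).filter fun d => P.IsLeaf tf R d ∧ ¬ P.SepFromTCR tf d b

/-- List 3 far. -/
def Input.list3far (b : Box) : Finset Box :=
  (P.list3Desc tf R b).filter fun d => P.SepFromTCR tf d b ∧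
    ∀ w ∈ P.list3Desc tf R b, w.IsAncestor d → ¬ P.SepFromTCR tf w b

/-- List 4. -/
def Input.list4 (b : Box) : Finset Box :=
  (P.boxes tf R).filter fun d => P.IsTargetOrAnc tf R b ∧ P.IsSourceBox tf R d ∧
    (((∃ a ∈ P.boxes tf R, a.IsAncestor b ∧ P.Colleague 2 d a) ∧
        P.Adjacent d b.parent ∧ ¬ P.Adjacent d b) ∨
      (P.Colleague 2 d b ∧ ¬ P.Adjacent d b))

/-- List 4 close. -/
def Input.list4close (b : Box) : Finset Box :=
  (P.boxes tf R).filter fun d => P.IsTargetOrAnc tf R b ∧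
    (∃ w ∈ P.boxes tf R, (w = b ∨ w.IsAncestor b) ∧ d ∈ P.list4 tf R w) ∧ ¬ P.TCRSepFrom tf b d

/-- List 4 far. -/
def Input.list4far (b : Box) : Finset Box :=
  (P.boxes tf R).filter fun d => P.IsTargetOrAnc tf R b ∧ P.TCRSepFrom tf b d ∧
    (d ∈ P.list4 tf R b ∨ (b ≠ Box.root ∧ d ∈ P.list4close tf R b.parent))

/-! ### Stages 2 to 9: evaluation

`p` is the FMM order and `q` the QBX order. Forming or evaluating an expansion of order `n` at or
from one point costs `n ^ 2`; translating an FMM expansion costs `p ^ 3`. All targets are assigned to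
QBX centers, so there are no interactions with conventional targets. -/

variable (p q : ℕ)

/-- Form the multipole expansions and shift them upward. -/
def Input.cost2 : ℕ :=
  ∑ b ∈ P.boxes tf R, (P.nS tf R b * p ^ 2 + (P.children tf R b).card * p ^ 3)

/-- Direct interactions of List 1. -/
def Input.cost3 : ℕ :=
  ∑ b ∈ P.boxes tf R, ∑ d ∈ P.list1 tf R b, P.nS tf R d * P.nC tf R b * q ^ 2

/-- Multipole-to-local translations of List 2. -/
def Input.cost4 : ℕ :=
  ∑ b ∈ P.boxes tf R, (P.list2 tf R b).card * p ^ 3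

/-- The number of sources in the leaf boxes among `d` and its descendants. -/
def Input.leafSources (d : Box) : ℕ :=
  ∑ e ∈ (P.boxes tf R).filter fun e => P.IsLeaf tf R e ∧ (e = d ∨ d.IsAncestor e), P.nS tf R e

/-- List 3 close (direct) and List 3 far. A box of List 3 far is either used through its multipole
expansion, at cost `p ^ 3` per center, or replaced by its leaf descendants, which are then treated
directly, at cost `q ^ 2` per source and center, whichever is cheaper. -/
def Input.cost5 : ℕ :=
  ∑ b ∈ P.boxes tf R,
    (∑ d ∈ P.list3close tf R b, P.nS tf R d * P.nC tf R b * q ^ 2 +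
      ∑ d ∈ P.list3far tf R b,
        min (P.nC tf R b * p ^ 3) (P.leafSources tf R d * P.nC tf R b * q ^ 2))

/-- List 4 close (direct) and List 4 far (formation of local expansions from sources). -/
def Input.cost6 : ℕ :=
  ∑ b ∈ P.boxes tf R,
    (∑ d ∈ P.list4close tf R b, P.nS tf R d * P.nC tf R b * q ^ 2 +
      ∑ d ∈ P.list4far tf R b, P.nS tf R d * p ^ 2)

/-- Shift the local expansions downward. -/
def Input.cost7 : ℕ :=
  ∑ b ∈ P.boxes tf R, (P.children tf R b).card * p ^ 3

/-- Translate the local expansions of the boxes to the QBX centers. -/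
def Input.cost8 : ℕ :=
  ∑ b ∈ P.boxes tf R, P.nC tf R b * p ^ 3

/-- Evaluate the QBX expansions at the targets assigned to the centers. -/
def Input.cost9 : ℕ :=
  ∑ b ∈ P.boxes tf R,
    (Finset.univ.filter fun t : Fin P.numT => P.Owns tf R b (P.ofCtr (P.assoc t))).card * q ^ 2

/-- The modeled cost of the evaluation stage. -/
def Input.evalCost : ℕ :=
  P.cost2 tf R p + P.cost3 tf R q + P.cost4 tf R p + P.cost5 tf R p q + P.cost6 tf R p q +
    P.cost7 tf R p + P.cost8 tf R p + P.cost9 tf R q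

end Lists

end

end Gigaqbx

/-!
The cost of the algorithm is bounded by charging every pair of interacting boxes either to a box, a
center or a source that occurs in boundedly many pairs, or to the neighborhood counts behind `M_C`.

*Tree build.* The boxes newly subdivided in round `k` have level exactly `k`
(`level_eq_of_mem_buildState_succ`), so every round but the last adds a level
(`lastRound_lt_numLevels`); a round costs at most `9 N`, because every particle has at most one
owner (`Owns.unique`) and an overfull box is not empty.

*Evaluation.* Three facts carry the estimates.

* Sources can always move down. Hence their owners are not subdivided and own at most `n_max`
  sources (`IsOctree.nS_le`). Unsubdivided boxes do not overlap, so only boundedly many of them that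
  are at least as large as `b` lie near `b` (`card_largeNear_le`). This bounds the larger boxes of
  List 1 and all of List 4, close and far.
* A box that is subdivided or overfull keeps only centers that the confinement rule holds back, and
  such a center has a radius of at least `√3 |b| t_f / 2`. The cube of radius `4 √3 r_c / t_f` around
  it then covers all `2`-colleagues of the box, so that the smaller boxes of List 1 and all of List 3
  are paid for by `M_C` (`Suspended.card_mul_nC_le`). Every other box is unsubdivided and has at most
  `n_max` centers (`IsOctree.suspended_or`).
* For these other boxes, the smaller boxes of List 1 are charged to their sources
  (`IsOctree.sum_list1small_le`). In List 3 all interactions may be taken to be direct; a source lies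
  below the `2`-colleagues of at most `125` boxes of each level
  (`card_filter_descColleague_le`), whence the term `N L`.

*Level restriction.* Around an unsubdivided box `b` of a level-restricted tree the boxes can shrink
only gradually: within the cube of radius `(3 - 2 / 2 ^ j)|b|` no cell `j` levels finer than `b` is
subdivided (`LevelRestricted.notMem_of_near`). If `t_f < √3 - 1`, the target confinement region of `b`
has radius `√3 |b| (1 + t_f) < 3 |b|`, so some fixed `j` (depending on `t_f` only) gives a cube larger
than this region, and boxes not separated from the region are at most about `j` levels finer than `b`
(`LevelRestricted.level_le_of_not_sepFromTCR`). List 3 close consists of such boxes and List 3 far of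
such boxes' children and of boxes of List 3, so both have bounded size and the term `N L` disappears.
-/

namespace Gigaqbx

noncomputable section

open scoped Classical

/-! ### The tree order on boxes -/

/-- `a` is `b` or an ancestor of `b`. -/
def Box.Contains (a b : Box) : Prop :=
  a.level ≤ b.level ∧ ∀ i, a.idx i = b.idx i / 2 ^ (b.level - a.level)

theorem Box.Contains.refl (a : Box) : a.Contains a := ⟨le_rfl, fun i => by simp⟩

theorem Box.Contains.eq_of_level_le {a b : Box} (h : a.Contains b) (hl : b.level ≤ a.level) :
    a = b := by
  have hl' := le_antisymm h.1 hl
  ext i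
  · exact hl'
  · simpa [hl'] using h.2 i

theorem Box.IsAncestor.contains {a b : Box} (h : a.IsAncestor b) : a.Contains b :=
  ⟨h.1.le, h.2⟩

theorem Box.contains_iff {a b : Box} : a.Contains b ↔ b = a ∨ a.IsAncestor b := by
  constructor
  · intro h
    rcases h.1.lt_or_eq with hl | hl
    · exact Or.inr ⟨hl, h.2⟩
    · exact Or.inl (h.eq_of_level_le hl.ge).symm
  · rintro (rfl | h)
    · exact .refl _
    · exact h.contains

theorem Box.Contains.trans {a b c : Box} (h : a.Contains b) (h' : b.Contains c) :
    a.Contains c := by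
  refine ⟨h.1.trans h'.1, fun i => ?_⟩
  rw [h.2, h'.2, Nat.div_div_eq_div_mul, ← pow_add]
  congr 2
  have := h.1
  have := h'.1
  omega

theorem Box.IsAncestor.trans_contains {a b c : Box} (h : a.IsAncestor b) (h' : b.Contains c) :
    a.IsAncestor c :=
  ⟨h.1.trans_le h'.1, (h.contains.trans h').2⟩

/-- Two boxes that contain a common box are nested. -/
theorem Box.Contains.of_contains {a b c : Box} (ha : a.Contains c) (hb : b.Contains c)
    (hl : a.level ≤ b.level) : a.Contains b := by
  refine ⟨hl, fun i => ?_⟩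
  rw [ha.2, hb.2, Nat.div_div_eq_div_mul, ← pow_add]
  congr 2
  have := hb.1
  omega

/-- The index of a cell, in units of the cells of a finer level. -/
theorem Box.Contains.idx_bounds {a b : Box} (h : a.Contains b) (i : Fin 3) :
    a.idx i * 2 ^ (b.level - a.level) ≤ b.idx i ∧
      b.idx i + 1 ≤ (a.idx i + 1) * 2 ^ (b.level - a.level) := by
  have hp : 0 < 2 ^ (b.level - a.level) := by positivity
  rw [h.2]
  exact ⟨Nat.div_mul_le_self _ _, Nat.lt_div_mul_add hp |>.trans_eq (by ring)⟩

theorem Box.isAncestor_child (b : Box) (o : Fin 3 → Bool) : b.IsAncestor (b.child o) := by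
  refine ⟨Nat.lt_succ_self _, fun i => ?_⟩
  have : (o i).toNat < 2 := Bool.toNat_lt _
  simp only [Box.child, Nat.add_sub_cancel_left, pow_one]
  omega

theorem Box.parent_isAncestor {b : Box} (h : 0 < b.level) : b.parent.IsAncestor b := by
  refine ⟨Nat.sub_lt h one_pos, fun i => ?_⟩
  have : b.level - b.parent.level = 1 := by simp only [Box.parent]; omega
  rw [this, pow_one]
  rfl

theorem Box.IsAncestor.contains_parent {a b : Box} (h : a.IsAncestor b) :
    a.Contains b.parent := by
  have := h.1
  exact h.contains.of_contains (Box.parent_isAncestor (by omega)).contains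
    (by simp only [Box.parent]; omega)

@[simp] theorem Box.child_parent (b : Box) (o : Fin 3 → Bool) : (b.child o).parent = b := by
  refine (Box.Contains.eq_of_level_le (b.isAncestor_child o).contains_parent ?_).symm
  simp [Box.parent, Box.child]

theorem Box.exists_eq_parent_child {b : Box} (h : 0 < b.level) : ∃ o, b = b.parent.child o := by
  refine ⟨fun i => decide (b.idx i % 2 = 1), ?_⟩
  ext i
  · simp only [Box.child, Box.parent]; omega
  · simp only [Box.child, Box.parent]
    rcases Nat.mod_two_eq_zero_or_one (b.idx i) with h | h
    · simp [h]; omega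
    · simp [h]; omega

/-! ### Counting boxes -/

/-- The boxes of level `l` in the block of `n ^ 3` cells with lowest index vector `A`. -/
def window (l : ℕ) (A : Fin 3 → ℕ) (n : ℕ) : Finset Box :=
  (Fintype.piFinset fun i => Finset.Ico (A i) (A i + n)).image (Box.mk l)

theorem card_window_le (l : ℕ) (A : Fin 3 → ℕ) (n : ℕ) : (window l A n).card ≤ n ^ 3 := by
  refine Finset.card_image_le.trans ?_
  simp [Fintype.card_piFinset]

theorem mem_window {l : ℕ} {A : Fin 3 → ℕ} {n : ℕ} {b : Box} (hl : b.level = l)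
    (h : ∀ i, A i ≤ b.idx i ∧ b.idx i < A i + n) : b ∈ window l A n := by
  refine Finset.mem_image.2 ⟨b.idx, ?_, ?_⟩
  · simpa [Fintype.mem_piFinset] using h
  · subst hl; rfl

/-! ### The boxes of a tree -/

theorem mem_allBoxes {R : Finset Box} {b : Box} :
    b ∈ allBoxes R ↔ b = Box.root ∨ ∃ r ∈ R, ∃ o, r.child o = b := by
  simp [allBoxes]

theorem root_mem_allBoxes (R : Finset Box) : Box.root ∈ allBoxes R :=
  mem_allBoxes.2 (Or.inl rfl)

theorem child_mem_allBoxes {R : Finset Box} {b : Box} (h : b ∈ R) (o : Fin 3 → Bool) :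
    b.child o ∈ allBoxes R :=
  mem_allBoxes.2 (Or.inr ⟨b, h, o, rfl⟩)

theorem isAncestor_mem {R : Finset Box} (hR : R ⊆ allBoxes R) {a b : Box}
    (hb : b ∈ allBoxes R) (h : a.IsAncestor b) : a ∈ R := by
  induction hn : b.level generalizing b with
  | zero => have := h.1; omega
  | succ n ih =>
    obtain rfl | ⟨r, hr, o, rfl⟩ := mem_allBoxes.1 hb
    · simp [Box.root] at hn
    · have hc := h.contains_parent
      rw [Box.child_parent] at hc
      rcases Box.contains_iff.1 hc with rfl | h'
      · exact hr
      · exact ih (hR hr) h' (by simpa [Box.child] using hn)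

theorem idx_lt_two_pow {R : Finset Box} (hR : R ⊆ allBoxes R) {b : Box} (hb : b ∈ allBoxes R)
    (i : Fin 3) : b.idx i < 2 ^ b.level := by
  induction hn : b.level generalizing b with
  | zero =>
    obtain rfl | ⟨r, hr, o, rfl⟩ := mem_allBoxes.1 hb
    · simp [Box.root]
    · simp [Box.child] at hn
  | succ n ih =>
    obtain rfl | ⟨r, hr, o, rfl⟩ := mem_allBoxes.1 hb
    · simp [Box.root] at hn
    · have := ih (hR hr) (by simpa [Box.child] using hn)
      have h2 : (o i).toNat < 2 := Bool.toNat_lt _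
      simp only [Box.child, pow_succ]
      omega

/-- The unsubdivided boxes of a tree cover the root box: above every cell of the grid that is not
subdivided there is one of them. -/
theorem exists_unsubdivided_contains {R : Finset Box} {c : Box}
    (hc : ∀ i, c.idx i < 2 ^ c.level) (hcR : c ∉ R) :
    ∃ e ∈ allBoxes R \ R, e.Contains c := by
  induction hn : c.level generalizing c with
  | zero =>
    refine ⟨c, Finset.mem_sdiff.2 ⟨mem_allBoxes.2 (Or.inl ?_), hcR⟩, .refl c⟩
    ext i
    · exact hn
    · have := hc i
      rw [hn] at this
      simpa [Box.root] using this
  | succ n ih =>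
    by_cases hp : c.parent ∈ R
    · refine ⟨c, Finset.mem_sdiff.2 ⟨?_, hcR⟩, .refl c⟩
      obtain ⟨o, ho⟩ := Box.exists_eq_parent_child (b := c) (by omega)
      rw [ho]
      exact child_mem_allBoxes hp o
    · have hv : ∀ i, c.parent.idx i < 2 ^ c.parent.level := fun i => by
        have := hc i
        simp only [Box.parent, hn, pow_succ, Nat.add_sub_cancel] at this ⊢
        omega
      obtain ⟨e, he, hec⟩ := ih hv hp (by simp [Box.parent, hn])
      exact ⟨e, he, hec.trans (Box.parent_isAncestor (by omega)).contains⟩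

theorem unsubdivided_unique {R : Finset Box} (hR : R ⊆ allBoxes R) {a b c : Box}
    (ha : a ∈ allBoxes R \ R) (hb : b ∈ allBoxes R \ R) (hac : a.Contains c)
    (hbc : b.Contains c) : a = b := by
  rw [Finset.mem_sdiff] at ha hb
  rcases le_total a.level b.level with h | h
  · rcases Box.contains_iff.1 (hac.of_contains hbc h) with h | h
    · exact h.symm
    · exact absurd (isAncestor_mem hR hb.1 h) ha.2
  · rcases Box.contains_iff.1 (hbc.of_contains hac h) with h | h
    · exact h
    · exact absurd (isAncestor_mem hR ha.1 h) hb.2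

/-- `d` is at least as large as `b`, and some cell of the size of `b` inside `d` is within `m`
cells of `b` along every axis. -/
def Box.LargeNear (m : ℕ) (d b : Box) : Prop :=
  ∃ c : Box, c.level = b.level ∧ d.Contains c ∧
    ∀ i, c.idx i ≤ b.idx i + m ∧ b.idx i ≤ c.idx i + m

/-- Only boundedly many unsubdivided boxes at least as large as `b` are near `b`, because they are
disjoint and each of them contains a cell of the size of `b` near `b`. -/
theorem card_largeNear_le {R : Finset Box} (hR : R ⊆ allBoxes R) (m : ℕ) (b : Box)
    {F : Finset Box} (hF : ∀ d ∈ F, d ∈ allBoxes R \ R) (h : ∀ d ∈ F, d.LargeNear m b) :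
    F.card ≤ (2 * m + 1) ^ 3 := by
  choose! c hl hdc hi using h
  refine le_trans ?_ (card_window_le b.level (fun i => b.idx i - m) (2 * m + 1))
  refine Finset.card_le_card_of_injOn c (fun d hd => ?_) (fun d hd d' hd' hcc => ?_)
  · refine mem_window (hl d hd) fun i => ?_
    have := hi d hd i
    omega
  · exact unsubdivided_unique hR (hF d hd) (hF d' hd') (hdc d hd) (hcc ▸ hdc d' hd')

/-! ### Coordinates of boxes -/

namespace Input

section

variable (P : Input)

theorem boxRad_pos (b : Box) : 0 < P.boxRad b := div_pos P.rootRad_pos (by positivity)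

theorem boxRad_child (b : Box) (o : Fin 3 → Bool) : P.boxRad (b.child o) = P.boxRad b / 2 := by
  simp only [boxRad, Box.child, pow_succ]
  field_simp

theorem boxRad_eq_mul {a b : Box} (h : a.level ≤ b.level) :
    P.boxRad a = 2 ^ (b.level - a.level) * P.boxRad b := by
  obtain ⟨k, hk⟩ := Nat.exists_eq_add_of_le h
  simp only [boxRad, hk, Nat.add_sub_cancel_left, pow_add]
  field_simp

theorem boxRad_anti {a b : Box} (h : a.level ≤ b.level) : P.boxRad b ≤ P.boxRad a := by
  rw [P.boxRad_eq_mul h]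
  exact le_mul_of_one_le_left (P.boxRad_pos b).le (one_le_pow₀ one_le_two)

theorem boxRad_congr {a b : Box} (h : a.level = b.level) : P.boxRad a = P.boxRad b := by
  simp [boxRad, h]

/-- The corner of the root box with the smallest coordinates. -/
def corner (i : Fin 3) : ℝ := P.rootCtr i - P.rootRad

theorem boxCtr_apply (b : Box) (i : Fin 3) :
    P.boxCtr b i = P.corner i + (2 * (b.idx i : ℝ) + 1) * P.boxRad b := rfl

theorem mem_region_iff {b : Box} {x : Pt} :
    x ∈ P.region b ↔ ∀ i, P.corner i + 2 * (b.idx i : ℝ) * P.boxRad b ≤ x i ∧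
      x i ≤ P.corner i + 2 * ((b.idx i : ℝ) + 1) * P.boxRad b := by
  refine forall_congr' fun i => ?_
  rw [P.boxCtr_apply, abs_le]
  constructor <;> rintro ⟨h1, h2⟩ <;> constructor <;> linarith

theorem boxCtr_mem_region (b : Box) : P.boxCtr b ∈ P.region b := fun i => by
  simpa using (P.boxRad_pos b).le

theorem region_root : P.region Box.root = cube P.rootRad P.rootCtr := by
  ext x
  refine forall_congr' fun i => ?_
  simp [boxCtr_apply, corner, boxRad, Box.root]

theorem region_subset_of_contains {a b : Box} (h : a.Contains b) : P.region b ⊆ P.region a := by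
  intro x hx
  rw [mem_region_iff] at hx ⊢
  intro i
  obtain ⟨h1, h2⟩ := hx i
  obtain ⟨h3, h4⟩ := h.idx_bounds i
  have h3' : (a.idx i : ℝ) * 2 ^ (b.level - a.level) ≤ b.idx i := by exact_mod_cast h3
  have h4' : (b.idx i : ℝ) + 1 ≤ (a.idx i + 1) * 2 ^ (b.level - a.level) := by exact_mod_cast h4
  have hr := (P.boxRad_pos b).le
  rw [P.boxRad_eq_mul h.1]
  constructor
  · have := mul_le_mul_of_nonneg_right h3' hr
    linarith
  · have := mul_le_mul_of_nonneg_right h4' hr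
    linarith

theorem Colleague.idx {P : Input} {d b : Box} (h : P.Colleague 2 d b) (i : Fin 3) :
    d.idx i ≤ b.idx i + 2 ∧ b.idx i ≤ d.idx i + 2 := by
  have h1 := h.2 (P.boxCtr_mem_region d) i
  have hr := P.boxRad_pos b
  rw [P.boxCtr_apply, P.boxCtr_apply, P.boxRad_congr h.1, abs_le] at h1
  obtain ⟨h1, h2⟩ := h1
  push_cast at h1 h2
  have h1' : -5 ≤ 2 * ((d.idx i : ℝ) - b.idx i) := by
    refine le_of_mul_le_mul_right ?_ hr
    linarith
  have h2' : 2 * ((d.idx i : ℝ) - b.idx i) ≤ 5 := by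
    refine le_of_mul_le_mul_right ?_ hr
    linarith
  have h1'' : -5 ≤ 2 * ((d.idx i : ℤ) - b.idx i) := by exact_mod_cast h1'
  have h2'' : 2 * ((d.idx i : ℤ) - b.idx i) ≤ 5 := by exact_mod_cast h2'
  omega

/-- Adjacency, axis by axis. -/
theorem adjacent_iff {a b : Box} : P.Adjacent a b ↔ ∀ i,
    (a.idx i : ℝ) * P.boxRad a ≤ (b.idx i + 1) * P.boxRad b ∧
      (b.idx i : ℝ) * P.boxRad b ≤ (a.idx i + 1) * P.boxRad a := by
  have ha := P.boxRad_pos a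
  have hb := P.boxRad_pos b
  constructor
  · rintro ⟨x, hx, hx'⟩ i
    obtain ⟨h1, h2⟩ := P.mem_region_iff.1 hx i
    obtain ⟨h3, h4⟩ := P.mem_region_iff.1 hx' i
    constructor <;> linarith
  · intro h
    refine ⟨WithLp.toLp 2 fun i => P.corner i +
      2 * max ((a.idx i : ℝ) * P.boxRad a) ((b.idx i : ℝ) * P.boxRad b), ?_, ?_⟩
    all_goals
      rw [mem_region_iff]
      intro i
      obtain ⟨h1, h2⟩ := h i
      simp only
      constructor
    · have := le_max_left ((a.idx i : ℝ) * P.boxRad a) ((b.idx i : ℝ) * P.boxRad b)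
      linarith
    · have : max ((a.idx i : ℝ) * P.boxRad a) ((b.idx i : ℝ) * P.boxRad b) ≤
        (a.idx i + 1) * P.boxRad a := max_le (by linarith) h2
      linarith
    · have := le_max_right ((a.idx i : ℝ) * P.boxRad a) ((b.idx i : ℝ) * P.boxRad b)
      linarith
    · have : max ((a.idx i : ℝ) * P.boxRad a) ((b.idx i : ℝ) * P.boxRad b) ≤
        (b.idx i + 1) * P.boxRad b := max_le h1 (by linarith)
      linarith

theorem Adjacent.symm {P : Input} {a b : Box} (h : P.Adjacent a b) : P.Adjacent b a := by
  unfold Adjacent at h ⊢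
  rwa [Set.inter_comm]

theorem Adjacent.of_contains {P : Input} {a b c : Box} (h : P.Adjacent b c) (ha : a.Contains b) :
    P.Adjacent a c :=
  h.mono (Set.inter_subset_inter_left _ (P.region_subset_of_contains ha))

theorem adjacent_of_contains {a b : Box} (h : a.Contains b) : P.Adjacent a b :=
  ⟨P.boxCtr b, P.region_subset_of_contains h (P.boxCtr_mem_region b), P.boxCtr_mem_region b⟩

theorem exists_mem_region_child {b : Box} {x : Pt} (hx : x ∈ P.region b) :
    x ∈ P.region (b.child fun i => decide (P.boxCtr b i ≤ x i)) := by
  rw [mem_region_iff] at hx ⊢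
  intro i
  obtain ⟨h1, h2⟩ := hx i
  have hc := P.boxCtr_apply b i
  rw [boxRad_child]
  by_cases h : P.boxCtr b i ≤ x i
  · simp only [Box.child, h, decide_true, Bool.toNat_true]
    push_cast
    constructor <;> linarith
  · have h' := not_le.1 h
    simp only [Box.child, h, decide_false, Bool.toNat_false]
    push_cast
    constructor <;> linarith

theorem Adjacent.exists_child {P : Input} {a b : Box} (h : P.Adjacent a b) :
    ∃ o, P.Adjacent (a.child o) b := by
  obtain ⟨x, hx, hx'⟩ := h
  exact ⟨_, x, P.exists_mem_region_child hx, hx'⟩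

/-- Inside a box of the tree that touches `b` there is an unsubdivided box that touches `b`. -/
theorem Adjacent.exists_unsubdivided {P : Input} {R : Finset Box} {a b : Box}
    (h : P.Adjacent a b) (ha : a ∈ allBoxes R) :
    ∃ d ∈ allBoxes R \ R, a.level ≤ d.level ∧ P.Adjacent d b := by
  induction hn : R.sup Box.level + 1 - a.level generalizing a with
  | zero =>
    refine ⟨a, Finset.mem_sdiff.2 ⟨ha, fun haR => ?_⟩, le_rfl, h⟩
    have := Finset.le_sup (f := Box.level) haR
    omega
  | succ n ih =>
    by_cases haR : a ∈ R
    · obtain ⟨o, ho⟩ := h.exists_child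
      have hl : (a.child o).level = a.level + 1 := rfl
      obtain ⟨d, hd, hl', hd'⟩ := ih ho (child_mem_allBoxes haR o) (by omega)
      exact ⟨d, hd, by omega, hd'⟩
    · exact ⟨a, Finset.mem_sdiff.2 ⟨ha, haR⟩, le_rfl, h⟩

/-- A box at least as large as `b` that meets the cube of radius `9|b|` around the center of `b`
contains a cell of the size of `b` at most five cells away from `b`. -/
theorem largeNear_of_mem {d b : Box} (hl : d.level ≤ b.level) {y : Pt} (hy : y ∈ P.region d)
    (h : ∀ i, |P.boxCtr b i - y i| ≤ 9 * P.boxRad b) : d.LargeNear 5 b := by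
  set e := 2 ^ (b.level - d.level) with he
  have hpos : 0 < e := by positivity
  have hr := P.boxRad_pos b
  have key : ∀ i, d.idx i * e ≤ b.idx i + 5 ∧ b.idx i + 1 ≤ (d.idx i + 1) * e + 5 := by
    intro i
    obtain ⟨h1, h2⟩ := P.mem_region_iff.1 hy i
    obtain ⟨h3, h4⟩ := abs_le.1 (h i)
    rw [P.boxCtr_apply] at h3 h4
    rw [P.boxRad_eq_mul hl] at h1 h2
    have h5 : (d.idx i : ℝ) * 2 ^ (b.level - d.level) ≤ b.idx i + 5 := by
      refine le_of_mul_le_mul_right ?_ hr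
      linarith
    have h6 : (b.idx i : ℝ) + 1 ≤ (d.idx i + 1) * 2 ^ (b.level - d.level) + 5 := by
      refine le_of_mul_le_mul_right ?_ hr
      linarith
    exact ⟨by exact_mod_cast h5, by exact_mod_cast h6⟩
  refine ⟨⟨b.level, fun i => max (d.idx i * e) (min (b.idx i) ((d.idx i + 1) * e - 1))⟩, rfl,
    ⟨hl, fun i => ?_⟩, fun i => ?_⟩
  · symm
    rw [Nat.div_eq_iff (by positivity)]
    have : d.idx i * e + e = (d.idx i + 1) * e := by ring
    simp only [← he]
    omega
  · have := key i
    have : d.idx i * e + e = (d.idx i + 1) * e := by ring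
    simp only
    omega

/-! ### Placement of particles -/

variable {P} {tf : ℝ} {R S : Finset Box}

theorem Reaches.mem_allBoxes {x : P.Particle} {b : Box} (h : P.Reaches tf R x b) :
    b ∈ allBoxes R := by
  cases h with
  | root => exact root_mem_allBoxes R
  | step b _ hb _ => exact child_mem_allBoxes hb _

theorem Reaches.mem_boxes {x : P.Particle} {b : Box} (h : P.Reaches tf R x b) :
    b ∈ P.boxes tf R :=
  Finset.mem_filter.2 ⟨h.mem_allBoxes, Or.inr ⟨x, h⟩⟩

theorem boxes_subset_allBoxes : P.boxes tf R ⊆ allBoxes R := Finset.filter_subset _ _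

theorem pos_mem_root (x : P.Particle) : P.pos x ∈ cube P.rootRad P.rootCtr := by
  rcases x with s | c | t
  · exact P.src_mem s
  · exact P.ball_subset c (Metric.mem_closedBall_self (P.rad_pos c).le)
  · exact P.tgt_mem t

theorem Reaches.pos_mem_region {x : P.Particle} {b : Box} (h : P.Reaches tf R x b) :
    P.pos x ∈ P.region b := by
  induction h with
  | root => rw [region_root]; exact pos_mem_root x
  | step b _ _ _ ih => exact P.exists_mem_region_child ih

theorem Reaches.mono (hRS : R ⊆ S) {x : P.Particle} {b : Box} (h : P.Reaches tf R x b) :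
    P.Reaches tf S x b := by
  induction h with
  | root => exact .root
  | step b _ hb hd ih => exact .step b ih (hRS hb) hd

/-- Whether a particle reaches a box depends only on the subdivided boxes of lower level. -/
theorem Reaches.of_forall_level_lt {n : ℕ} (hRS : ∀ r ∈ R, r.level < n → r ∈ S)
    {x : P.Particle} {b : Box} (h : P.Reaches tf R x b) (hb : b.level ≤ n) :
    P.Reaches tf S x b := by
  induction h with
  | root => exact .root
  | step b _ hbR hd ih =>
    have hb' : b.level < n := hb
    exact .step b (ih hb'.le) (hRS b hbR hb') hd

theorem Reaches.eq_of_level_eq {x : P.Particle} {a b : Box} (ha : P.Reaches tf R x a)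
    (hb : P.Reaches tf R x b) (h : a.level = b.level) : a = b := by
  induction ha generalizing b with
  | root =>
    cases hb with
    | root => rfl
    | step => simp [Box.root, childAt, Box.child] at h
  | step a _ _ _ ih =>
    cases hb with
    | root => simp [Box.root, childAt, Box.child] at h
    | step b hb _ _ =>
      have : a.level + 1 = b.level + 1 := h
      rw [ih hb (by omega)]

theorem Reaches.exists_level_eq {x : P.Particle} {b : Box} (h : P.Reaches tf R x b) {k : ℕ}
    (hk : k < b.level) :
    ∃ a, a.level = k ∧ P.Reaches tf R x a ∧ a ∈ R ∧ P.CanDescend tf a x := by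
  induction h with
  | root => simp [Box.root] at hk
  | step b hb hbR hd ih =>
    have hk' : k < b.level + 1 := hk
    rcases (Nat.lt_succ_iff.1 hk').lt_or_eq with h | h
    · exact ih h
    · exact ⟨b, h.symm, hb, hbR, hd⟩

theorem Owns.mem_boxes {x : P.Particle} {b : Box} (h : P.Owns tf R b x) : b ∈ P.boxes tf R :=
  h.1.mem_boxes

/-- No particle is owned by two boxes. -/
theorem Owns.unique {x : P.Particle} {a b : Box} (ha : P.Owns tf R a x)
    (hb : P.Owns tf R b x) : a = b := by
  rcases lt_trichotomy a.level b.level with h | h | h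
  · obtain ⟨c, hc, hx, hd⟩ := hb.1.exists_level_eq h
    exact absurd (hx.eq_of_level_eq ha.1 hc ▸ hd) ha.2
  · exact ha.1.eq_of_level_eq hb.1 h
  · obtain ⟨c, hc, hx, hd⟩ := ha.1.exists_level_eq h
    exact absurd (hx.eq_of_level_eq hb.1 hc ▸ hd) hb.2

theorem sum_card_owns_le {ι : Type*} [Fintype ι] (F : Finset Box) (g : ι → P.Particle) :
    ∑ b ∈ F, (Finset.univ.filter fun i => P.Owns tf R b (g i)).card ≤
      (Finset.univ.filter fun i => ∃ b ∈ F, P.Owns tf R b (g i)).card := by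
  rw [← Finset.card_biUnion]
  · refine Finset.card_le_card fun i hi => ?_
    simpa using hi
  · intro a _ b _ hab
    refine Finset.disjoint_left.2 fun i hi hi' => hab ?_
    exact (Finset.mem_filter.1 hi).2.unique (Finset.mem_filter.1 hi').2

theorem sum_numOwned_le (F : Finset Box) :
    ∑ b ∈ F, P.numOwned tf R b ≤ P.numParticles := by
  refine (sum_card_owns_le F id).trans ((Finset.card_le_univ _).trans_eq ?_)
  simp [numParticles, add_assoc]

theorem sum_nS_le_card (F : Finset Box) :
    ∑ b ∈ F, P.nS tf R b ≤
      (Finset.univ.filter fun s => ∃ b ∈ F, P.Owns tf R b (P.ofSrc s)).card :=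
  sum_card_owns_le F _

theorem sum_nS_le (F : Finset Box) : ∑ b ∈ F, P.nS tf R b ≤ P.numS :=
  (sum_nS_le_card F).trans ((Finset.card_le_univ _).trans_eq (Fintype.card_fin _))

theorem sum_nC_le (F : Finset Box) : ∑ b ∈ F, P.nC tf R b ≤ P.numC :=
  (sum_card_owns_le F _).trans ((Finset.card_le_univ _).trans_eq (Fintype.card_fin _))

theorem nS_le_numOwned (b : Box) : P.nS tf R b ≤ P.numOwned tf R b :=
  Finset.card_le_card_of_injOn P.ofSrc (fun s hs => by simpa using hs)
    Sum.inl_injective.injOn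

theorem nC_le_numOwned (b : Box) : P.nC tf R b ≤ P.numOwned tf R b :=
  Finset.card_le_card_of_injOn P.ofCtr (fun s hs => by simpa using hs)
    (Sum.inr_injective.comp Sum.inl_injective).injOn

end

section

variable {P : Input} {tf : ℝ} {nmax : ℕ}

/-! ### The tree build -/

theorem buildState_subset_succ (k : ℕ) :
    P.buildState tf nmax k ⊆ P.buildState tf nmax (k + 1) :=
  Finset.subset_union_left

theorem buildState_mono : Monotone (P.buildState tf nmax) :=
  monotone_nat_of_le_succ buildState_subset_succ

theorem level_lt_of_mem_buildState {k : ℕ} {r : Box} (h : r ∈ P.buildState tf nmax k) :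
    r.level < k := by
  induction k generalizing r with
  | zero => simp [buildState] at h
  | succ k ih =>
    rcases Finset.mem_union.1 h with h | h
    · exact (ih h).trans k.lt_succ_self
    · have := boxes_subset_allBoxes (Finset.mem_filter.1 (Finset.mem_filter.1 h).1).1
      obtain rfl | ⟨s, hs, o, rfl⟩ := mem_allBoxes.1 this
      · exact k.succ_pos
      · exact Nat.succ_lt_succ (ih hs)

/-- The boxes newly subdivided in round `k` (counted from zero) have level `k`: a box of lower level
owned the same particles in the round whose number is its level, and was subdivided then. -/
theorem level_eq_of_mem_buildState_succ {k : ℕ} {r : Box}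
    (h : r ∈ P.buildState tf nmax (k + 1)) (h' : r ∉ P.buildState tf nmax k) :
    r.level = k := by
  induction k using Nat.strong_induction_on generalizing r with
  | _ k ih =>
  by_contra hne
  have hlt : r.level < k := by
    have := level_lt_of_mem_buildState h
    omega
  -- In the two states the boxes of level below that of `r` agree.
  have hagree : ∀ m, r.level ≤ m → m ≤ k → ∀ s ∈ P.buildState tf nmax m, s.level < r.level →
      s ∈ P.buildState tf nmax r.level := by
    intro m hm
    induction m, hm using Nat.le_induction with
    | base => exact fun _ s hs _ => hs
    | succ m hm ihm =>
      intro hmk s hs hl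
      refine ihm (by omega) s ?_ hl
      by_contra hsm
      have := ih m (by omega) hs hsm
      omega
  have hreach : ∀ x, P.Reaches tf (P.buildState tf nmax k) x r →
      P.Reaches tf (P.buildState tf nmax r.level) x r := fun x hx =>
    hx.of_forall_level_lt (hagree k hlt.le le_rfl) le_rfl
  have hnot : r ∉ P.buildState tf nmax r.level := fun hr => h' (buildState_mono hlt.le hr)
  have howns : ∀ x, P.Owns tf (P.buildState tf nmax k) r x →
      P.Owns tf (P.buildState tf nmax r.level) r x := fun x hx =>
    ⟨hreach x hx.1, fun hr => hnot hr.1⟩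
  obtain ⟨hover, x, hx, hd⟩ := Finset.mem_filter.1 ((Finset.mem_union.1 h).resolve_left h')
  have hcard := (Finset.mem_filter.1 hover).2
  refine h' (buildState_mono (Nat.succ_le_of_lt hlt) (Finset.mem_union_right _ ?_))
  refine Finset.mem_filter.2 ⟨Finset.mem_filter.2 ⟨(howns x hx).mem_boxes, hcard.trans_le ?_⟩,
    x, howns x hx, hd⟩
  exact Finset.card_le_card fun y hy => by
    simpa using howns y (Finset.mem_filter.1 hy).2

/-- Every round but the last adds a level to the octree. -/
theorem lastRound_lt_numLevels :
    P.lastRound tf nmax < P.numLevels tf (P.buildTree tf nmax) := by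
  refine Nat.lt_succ_of_le ?_
  cases hK : P.lastRound tf nmax with
  | zero => exact Nat.zero_le _
  | succ k =>
    have hne : P.buildState tf nmax (k + 1) ≠ P.buildState tf nmax k := fun h =>
      Nat.notMem_of_lt_sInf (hK ▸ k.lt_succ_self : k < P.lastRound tf nmax) h
    obtain ⟨r, hr, hr'⟩ := Finset.exists_of_ssubset
      ((buildState_subset_succ k).ssubset_of_ne hne.symm)
    obtain ⟨-, x, hx, hd⟩ := Finset.mem_filter.1 ((Finset.mem_union.1 hr).resolve_left hr')
    have hx' : P.Reaches tf (P.buildTree tf nmax) x (P.childAt r x) := by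
      rw [buildTree, hK]
      exact .step r (hx.1.mono (buildState_subset_succ k)) hr hd
    have := Finset.le_sup (f := Box.level) hx'.mem_boxes
    rwa [show (P.childAt r x).level = k + 1 from
      congrArg Nat.succ (level_eq_of_mem_buildState_succ hr hr')] at this

theorem roundCost_le (R : Finset Box) : P.roundCost tf nmax R ≤ 9 * P.numParticles := by
  refine le_trans (Finset.sum_le_sum fun b hb => ?_)
    ((Finset.mul_sum _ _ _).symm.trans_le (Nat.mul_le_mul_left 9
      (sum_numOwned_le (P := P) (tf := tf) (R := R) (P.overfull tf nmax R))))
  have := (Finset.mem_filter.1 hb).2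
  omega

theorem buildCost_le : P.buildCost tf nmax ≤
    9 * (P.numParticles * P.numLevels tf (P.buildTree tf nmax)) := by
  refine (Finset.sum_le_card_nsmul _ _ _ fun k _ => roundCost_le _).trans ?_
  rw [Finset.card_range, smul_eq_mul]
  calc _ ≤ P.numLevels tf (P.buildTree tf nmax) * (9 * P.numParticles) :=
        Nat.mul_le_mul_right _ lastRound_lt_numLevels
    _ = _ := by ring

end

section

variable {P : Input} {tf : ℝ} {nmax : ℕ} {R : Finset Box}

/-! ### Centers that cannot be moved further down -/

/-- Every QBX center owned by `b` is kept in `b` by the target confinement rule. -/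
def Suspended (P : Input) (tf : ℝ) (R : Finset Box) (b : Box) : Prop :=
  ∀ c, P.Owns tf R b (P.ofCtr c) → ¬ P.CanDescend tf b (P.ofCtr c)

theorem IsOctree.mem_of_canDescend (h : P.IsOctree tf nmax R) {b : Box} {x : P.Particle}
    (hx : P.Owns tf R b x) (hd : P.CanDescend tf b x) (hn : nmax < P.numOwned tf R b) :
    b ∈ R := by
  rw [← h.finished]
  exact Finset.mem_union_right _
    (Finset.mem_filter.2 ⟨Finset.mem_filter.2 ⟨hx.mem_boxes, hn⟩, x, hx, hd⟩)

theorem exists_owns_of_nS_ne_zero {b : Box} (h : P.nS tf R b ≠ 0) :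
    ∃ s, P.Owns tf R b (P.ofSrc s) := by
  obtain ⟨s, hs⟩ := Finset.card_pos.1 (Nat.pos_of_ne_zero h)
  exact ⟨s, (Finset.mem_filter.1 hs).2⟩

/-- Sources are not subject to the target confinement rule, so their owners are not subdivided. -/
theorem mem_sdiff_of_owns_src {b : Box} {s : Fin P.numS} (h : P.Owns tf R b (P.ofSrc s)) :
    b ∈ allBoxes R \ R :=
  Finset.mem_sdiff.2 ⟨h.1.mem_allBoxes, fun hb => h.2 ⟨hb, trivial⟩⟩

theorem IsOctree.nS_le (h : P.IsOctree tf nmax R) (b : Box) : P.nS tf R b ≤ nmax := by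
  by_contra! hn
  obtain ⟨s, hs⟩ := exists_owns_of_nS_ne_zero (Nat.ne_zero_of_lt hn)
  exact (Finset.mem_sdiff.1 (mem_sdiff_of_owns_src hs)).2
    (h.mem_of_canDescend hs trivial (hn.trans_le (nS_le_numOwned b)))

theorem IsOctree.suspended_or (h : P.IsOctree tf nmax R) (b : Box) :
    P.Suspended tf R b ∨ b ∉ R ∧ P.nC tf R b ≤ nmax := by
  by_cases hb : b ∈ R
  · exact Or.inl fun c hc hd => hc.2 ⟨hb, hd⟩
  · by_cases hn : P.numOwned tf R b ≤ nmax
    · exact Or.inr ⟨hb, (nC_le_numOwned b).trans hn⟩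
    · exact Or.inl fun c hc hd => hb (h.mem_of_canDescend hc hd (not_le.1 hn))

theorem dist_le_of_forall_abs_le {x y : Pt} {r : ℝ} (hr : 0 ≤ r) (h : ∀ i, |x i - y i| ≤ r) :
    dist x y ≤ √3 * r := by
  rw [EuclideanSpace.dist_eq]
  refine Real.sqrt_le_iff.2 ⟨by positivity, ?_⟩
  rw [mul_pow, Real.sq_sqrt (by norm_num)]
  refine (Finset.sum_le_card_nsmul _ _ (r ^ 2) fun i _ => ?_).trans_eq (by simp)
  rw [Real.dist_eq]
  exact pow_le_pow_left₀ (abs_nonneg _) (h i) 2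

theorem abs_sub_le_dist (x y : Pt) (i : Fin 3) : |x i - y i| ≤ dist x y := by
  simpa [Real.norm_eq_abs, dist_eq_norm] using PiLp.norm_apply_le (x - y) i

/-- A center that is kept in `b` has an expansion ball that is not small compared to `b`. -/
theorem lt_rad_of_not_canDescend {b : Box} {c : Fin P.numC} (hb : P.ctr c ∈ P.region b)
    (h : ¬ P.CanDescend tf b (P.ofCtr c)) : √3 * P.boxRad b * tf / 2 < P.rad c := by
  by_contra! hr
  refine h (Metric.closedBall_subset_closedBall' ?_)
  have hmem : P.ctr c ∈ P.region (P.childAt b (P.ofCtr c)) := P.exists_mem_region_child hb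
  have := dist_le_of_forall_abs_le (P.boxRad_pos _).le hmem
  have hrad : P.boxRad (P.childAt b (P.ofCtr c)) = P.boxRad b / 2 := P.boxRad_child _ _
  rw [hrad] at this ⊢
  linarith

/-- The number of sources in the neighborhood of the center `c` whose average over `c` is `M_C`. -/
def nearCount (P : Input) (tf : ℝ) (c : Fin P.numC) : ℕ :=
  (Finset.univ.filter fun s : Fin P.numS =>
    P.src s ∈ cube (4 * √3 * P.rad c / tf) (P.ctr c)).card

theorem numC_mul_avgNear : (P.numC : ℝ) * P.avgNear tf = (∑ c, P.nearCount tf c : ℕ) := by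
  rcases Nat.eq_zero_or_pos P.numC with h | h
  · have : IsEmpty (Fin P.numC) := by rw [h]; infer_instance
    simp [h]
  · have : (P.numC : ℝ) ≠ 0 := by positivity
    rw [avgNear, mul_div_cancel₀ _ this]
    simp [nearCount]

/-- The neighbor counts of the centers owned by `b`, added up. -/
def nearSum (P : Input) (tf : ℝ) (R : Finset Box) (b : Box) : ℕ :=
  ∑ c with P.Owns tf R b (P.ofCtr c), P.nearCount tf c

theorem sum_nearSum_le (F : Finset Box) :
    ∑ b ∈ F, P.nearSum tf R b ≤ ∑ c, P.nearCount tf c := by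
  simp only [nearSum, Finset.sum_filter]
  rw [Finset.sum_comm]
  refine Finset.sum_le_sum fun c _ => ?_
  rw [← Finset.sum_filter, Finset.sum_const, smul_eq_mul]
  refine (Nat.mul_le_mul_right _ (Finset.card_le_one.2 fun a ha b hb => ?_)).trans_eq (one_mul _)
  exact (Finset.mem_filter.1 ha).2.unique (Finset.mem_filter.1 hb).2

/-- The radius of the neighborhoods in the definition of `M_C` is so large that the neighborhood of
a center kept in `b` covers all `2`-colleagues of `b`. -/
theorem Suspended.card_mul_nC_le (htf : 0 < tf) {b : Box} (hb : P.Suspended tf R b)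
    {F : Finset (Fin P.numS)} (hF : ∀ s ∈ F, P.src s ∈ P.near 2 b) :
    F.card * P.nC tf R b ≤ P.nearSum tf R b := by
  rw [mul_comm, nC, nearSum, ← smul_eq_mul]
  refine Finset.card_nsmul_le_sum _ _ _ fun c hc => Finset.card_le_card fun s hs => ?_
  have hc := (Finset.mem_filter.1 hc).2
  have hmem := hc.1.pos_mem_region
  have hrad := lt_rad_of_not_canDescend hmem (hb c hc)
  refine Finset.mem_filter.2 ⟨Finset.mem_univ _, fun i => ?_⟩
  have h1 : |P.ctr c i - P.boxCtr b i| ≤ P.boxRad b := hmem i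
  have h2 := hF s hs i
  have h3 : 6 * P.boxRad b ≤ 4 * √3 * P.rad c / tf := by
    rw [le_div_iff₀ htf]
    have h4 := mul_lt_mul_of_pos_left hrad (show 0 < 4 * √3 by positivity)
    have h5 : √3 * √3 = 3 := Real.mul_self_sqrt (by norm_num)
    have h6 : 4 * √3 * (√3 * P.boxRad b * tf / 2) = 6 * P.boxRad b * tf := by
      linear_combination (2 * P.boxRad b * tf) * h5
    linarith
  push_cast at h2
  rw [abs_le] at *
  constructor <;> linarith [h1.1, h1.2, h2.1, h2.2]

/-! ### Counting pairs of boxes -/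

theorem IsOctree.sum_nS_le_of_largeNear (h : P.IsOctree tf nmax R) {m : ℕ} {b : Box}
    {F : Finset Box} (hF : ∀ d ∈ F, d.LargeNear m b) :
    ∑ d ∈ F, P.nS tf R d ≤ (2 * m + 1) ^ 3 * nmax := by
  rw [← Finset.sum_filter_ne_zero]
  refine (Finset.sum_le_card_nsmul _ _ nmax fun d _ => h.nS_le d).trans ?_
  refine Nat.mul_le_mul_right _ (card_largeNear_le h.sub_allBoxes m b (fun d hd => ?_)
    fun d hd => hF d (Finset.mem_filter.1 hd).1)
  obtain ⟨s, hs⟩ := exists_owns_of_nS_ne_zero (Finset.mem_filter.1 hd).2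
  exact mem_sdiff_of_owns_src hs

theorem Adjacent.largeNear {d b : Box} (h : P.Adjacent d b) (hl : d.level ≤ b.level) :
    d.LargeNear 5 b := by
  obtain ⟨y, hy, hy'⟩ := h
  refine P.largeNear_of_mem hl hy fun i => ?_
  have := hy' i
  have := P.boxRad_pos b
  rw [abs_sub_comm]
  linarith

theorem Adjacent.region_subset_near {d b : Box} (h : P.Adjacent d b) (hl : b.level ≤ d.level) :
    P.region d ⊆ P.near 2 b := by
  intro x hx i
  have h1 := P.mem_region_iff.1 hx i
  have h2 := P.adjacent_iff.1 h i
  have h3 := P.boxRad_anti hl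
  have h4 := P.boxRad_pos b
  rw [P.boxCtr_apply, abs_le]
  push_cast
  constructor <;> linarith [h1.1, h1.2, h2.1, h2.2]

theorem DescColleague.trans_contains {b d e : Box} (h : P.DescColleague tf R b d)
    (hd : d.Contains e) : P.DescColleague tf R b e := by
  obtain ⟨c, hc, hcb, hcd⟩ := h
  exact ⟨c, hc, hcb, hcd.trans_contains hd⟩

theorem DescColleague.region_subset_near {b d : Box} (h : P.DescColleague tf R b d) :
    P.region d ⊆ P.near 2 b := by
  obtain ⟨c, -, hcb, hcd⟩ := h
  exact (P.region_subset_of_contains hcd.contains).trans hcb.2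

theorem level_lt_numLevels {b : Box} (h : b ∈ P.boxes tf R) : b.level < P.numLevels tf R :=
  Nat.lt_succ_of_le (Finset.le_sup (f := Box.level) h)

/-- A box lies below the `2`-colleagues of at most `5 ^ 3` boxes of each level. -/
theorem card_filter_descColleague_le (d : Box) :
    ((P.boxes tf R).filter fun b => P.DescColleague tf R b d).card ≤
      125 * P.numLevels tf R := by
  have hsub : ((P.boxes tf R).filter fun b => P.DescColleague tf R b d) ⊆
      (Finset.range (P.numLevels tf R)).biUnion fun k =>
        window k (fun i => d.idx i / 2 ^ (d.level - k) - 2) 5 := by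
    intro b hb
    obtain ⟨hb, c, -, hcb, hcd⟩ := Finset.mem_filter.1 hb
    refine Finset.mem_biUnion.2 ⟨b.level, Finset.mem_range.2 (level_lt_numLevels hb),
      mem_window rfl fun i => ?_⟩
    have h1 := hcd.2 i
    rw [hcb.1] at h1
    have h2 := hcb.idx i
    omega
  refine (Finset.card_le_card hsub).trans (Finset.card_biUnion_le.trans ?_)
  refine (Finset.sum_le_card_nsmul _ _ 125 fun k _ => card_window_le _ _ _).trans ?_
  simp [mul_comm]

/-- The boxes of a bounded number of levels below the `2`-colleagues of `b` are boundedly many. -/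
theorem card_le_of_descColleague {b : Box} {m : ℕ} {F : Finset Box}
    (hF : ∀ d ∈ F, P.DescColleague tf R b d ∧ d.level ≤ b.level + m) :
    F.card ≤ (m + 1) * (5 * 2 ^ m) ^ 3 := by
  have hsub : F ⊆ (Finset.range (m + 1)).biUnion fun j =>
      window (b.level + j) (fun i => 2 ^ j * (b.idx i - 2)) (5 * 2 ^ j) := by
    intro d hd
    obtain ⟨⟨c, -, hcb, hcd⟩, hl⟩ := hF d hd
    have hl' : b.level < d.level := hcb.1 ▸ hcd.1
    refine Finset.mem_biUnion.2 ⟨d.level - b.level, Finset.mem_range.2 (by omega),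
      mem_window (by omega) fun i => ?_⟩
    obtain ⟨h1, h2⟩ := hcd.contains.idx_bounds i
    have h3 := hcb.idx i
    rw [hcb.1] at h1 h2
    set e := 2 ^ (d.level - b.level)
    constructor
    · calc e * (b.idx i - 2) ≤ e * c.idx i := Nat.mul_le_mul_left _ (by omega)
        _ ≤ d.idx i := by rwa [mul_comm]
    · calc d.idx i < (c.idx i + 1) * e := h2
        _ ≤ (b.idx i - 2 + 5) * e := Nat.mul_le_mul_right _ (by omega)
        _ = _ := by ring
  refine (Finset.card_le_card hsub).trans (Finset.card_biUnion_le.trans ?_)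
  refine (Finset.sum_le_card_nsmul _ _ ((5 * 2 ^ m) ^ 3) fun j hj => ?_).trans ?_
  · refine (card_window_le _ _ _).trans (Nat.pow_le_pow_left (Nat.mul_le_mul_left _ ?_) 3)
    exact Nat.pow_le_pow_right two_pos (Nat.lt_succ_iff.1 (Finset.mem_range.1 hj))
  · simp

end

section

variable {P : Input} {tf : ℝ} {R : Finset Box}

/-! ### Level-restricted octrees -/

theorem parent_mem {b : Box} (hb : b ∈ P.boxes tf R) (hl : 0 < b.level) :
    b.parent ∈ P.boxes tf R ∧ b.parent ∈ R := by
  obtain ⟨-, rfl | ⟨x, hx⟩⟩ := Finset.mem_filter.1 hb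
  · exact absurd hl (lt_irrefl 0)
  · cases hx with
    | root => exact absurd hl (lt_irrefl 0)
    | step c hc hcR hd =>
      rw [childAt, Box.child_parent]
      exact ⟨hc.mem_boxes, hcR⟩

/-- No subdivided box that touches an unsubdivided box `b` is smaller than `b`. -/
theorem LevelRestricted.level_le_of_adjacent (h : P.LevelRestricted R) {b w : Box}
    (hb : b ∈ allBoxes R \ R) (hw : w ∈ R) (hwb : P.Adjacent w b) : w.level ≤ b.level := by
  obtain ⟨o, ho⟩ := hwb.exists_child
  obtain ⟨d, hd, hl, hdb⟩ := ho.exists_unsubdivided (child_mem_allBoxes hw o)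
  have h1 := h d hd b hb hdb
  have h2 : w.level + 1 ≤ d.level := hl
  omega

/-- The gradation of a level-restricted tree around an unsubdivided box `a`: a cell that is `j`
levels finer than `a` and lies in the cube of radius `(3 - 2 / 2 ^ j)|a|` around the center of `a`
is not subdivided. Each step from `j` to `j + 1` adds one layer of the finer cells to the cube, and the
cells of that layer touch unsubdivided boxes at least as large as the cells of the previous step. -/
theorem LevelRestricted.notMem_of_near (h : P.LevelRestricted R) (hR : R ⊆ allBoxes R)
    {a : Box} (ha : a ∈ allBoxes R \ R) (j : ℕ) {Q : Box} (hl : Q.level = a.level + j)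
    (hQ : ∀ i, 2 ^ j * a.idx i + 1 ≤ Q.idx i + 2 ^ j ∧
      Q.idx i + 2 ≤ 2 ^ j * (a.idx i + 2)) : Q ∉ R := by
  induction j generalizing Q with
  | zero =>
    have : Q = a := by
      ext i
      · exact hl
      · have := hQ i
        omega
    rw [this]
    exact (Finset.mem_sdiff.1 ha).2
  | succ j ih =>
    intro hQR
    -- The cell `c` is `Q`, moved inwards by one along the axes where `Q` is in the new layer.
    set c : Box := ⟨Q.level, fun i =>
      if Q.idx i + 2 ^ (j + 1) = 2 ^ (j + 1) * a.idx i + 1 then Q.idx i + 1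
      else if Q.idx i + 2 = 2 ^ (j + 1) * (a.idx i + 2) then Q.idx i - 1
      else Q.idx i⟩ with hc
    have hpow : (2 : ℕ) ^ (j + 1) = 2 * 2 ^ j := by ring
    have hpos : 0 < 2 ^ j := by positivity
    have hcl : 0 < c.level := by simp only [hc]; omega
    have hpl : c.parent.level = a.level + j := by simp only [hc, Box.parent]; omega
    have hbd : ∀ i, Q.idx i ≤ c.idx i + 1 ∧ c.idx i ≤ Q.idx i + 1 := by
      intro i
      simp only [hc]
      split_ifs <;> omega
    have hin : ∀ i, 2 * (2 ^ j * a.idx i) + 2 ≤ c.idx i + 2 * 2 ^ j ∧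
        c.idx i + 3 ≤ 2 * (2 ^ j * a.idx i) + 4 * 2 ^ j := by
      intro i
      have h1 := hQ i
      have h2 : 2 * 2 ^ j * a.idx i = 2 * (2 ^ j * a.idx i) := by ring
      have h3 : 2 * 2 ^ j * (a.idx i + 2) = 2 * (2 ^ j * a.idx i) + 4 * 2 ^ j := by ring
      rw [hpow, h2, h3] at h1
      simp only [hc]
      rw [hpow, h2, h3]
      split_ifs <;> omega
    have hpar : ∀ i, c.parent.idx i = c.idx i / 2 := fun i => rfl
    have hpR : c.parent ∉ R := by
      refine ih hpl fun i => ?_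
      have h1 := hin i
      have h2 : 2 ^ j * (a.idx i + 2) = 2 ^ j * a.idx i + 2 * 2 ^ j := by ring
      rw [hpar, h2]
      omega
    have hvalid : ∀ i, c.parent.idx i < 2 ^ c.parent.level := by
      intro i
      have h1 := idx_lt_two_pow hR (hR hQR) i
      have h2 := idx_lt_two_pow hR (Finset.mem_sdiff.1 ha).1 i
      have h3 := hQ i
      have h4 : (2 : ℕ) ^ Q.level = 2 * 2 ^ c.parent.level := by
        rw [hl, hpl]; ring
      have h5 : (2 : ℕ) ^ c.parent.level = 2 ^ j * 2 ^ a.level := by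
        rw [hpl]; ring
      have h6 : 2 ^ j * a.idx i + 2 ^ j ≤ 2 ^ c.parent.level := by
        rw [h5]
        calc _ = 2 ^ j * (a.idx i + 1) := by ring
          _ ≤ _ := Nat.mul_le_mul_left _ h2
      rw [hpar]
      have h7 : 2 * 2 ^ j * a.idx i = 2 * (2 ^ j * a.idx i) := by ring
      rw [h4] at h1
      clear h4 h5
      generalize 2 ^ c.parent.level = V at h1 h6 ⊢
      rw [hpow, h7] at h3
      simp only [hc]
      rw [hpow, h7]
      split_ifs <;> omega
    obtain ⟨e, he, hec⟩ := exists_unsubdivided_contains hvalid hpR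
    have hadj : P.Adjacent c Q := by
      refine P.adjacent_iff.2 fun i => ?_
      have hr := (P.boxRad_pos Q).le
      have h1 : (Q.idx i : ℝ) ≤ c.idx i + 1 := by exact_mod_cast (hbd i).1
      have h2 : (c.idx i : ℝ) ≤ Q.idx i + 1 := by exact_mod_cast (hbd i).2
      rw [P.boxRad_congr (show c.level = Q.level from rfl)]
      exact ⟨mul_le_mul_of_nonneg_right h2 hr, mul_le_mul_of_nonneg_right h1 hr⟩
    have heQ : P.Adjacent Q e :=
      (hadj.of_contains (hec.trans (Box.parent_isAncestor hcl).contains)).symm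
    have h1 := h.level_le_of_adjacent he hQR heQ
    have h2 := hec.1
    omega

/-- In a level-restricted tree, a box that is not well separated from the target confinement region
of an unsubdivided box `b` is not much smaller than `b`, provided that this region lies in the open
cube of radius `3|b|` that the gradation of the tree exhausts. -/
theorem LevelRestricted.level_le_of_not_sepFromTCR (h : P.LevelRestricted R)
    (hR : R ⊆ allBoxes R) {m : ℕ} (hm : √3 * (1 + tf) + 4 / 2 ^ m ≤ 3) {b w : Box}
    (hb : b ∈ allBoxes R \ R) (hw : w ∈ allBoxes R) (hwb : ¬ P.SepFromTCR tf w b) :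
    w.level ≤ b.level + m := by
  by_contra! hlt
  set v : Box := ⟨b.level + m, fun i => w.idx i / 2 ^ (w.level - (b.level + m))⟩
  have hvw : v.IsAncestor w := ⟨hlt, fun i => rfl⟩
  have hvl : v.level = b.level + m := rfl
  refine absurd (isAncestor_mem hR hw hvw) (h.notMem_of_near hR hb m hvl fun i => ?_)
  simp only [SepFromTCR, not_forall, not_le] at hwb
  obtain ⟨y, hy, hyw⟩ := hwb
  have h1 : |P.boxCtr w i - P.boxCtr b i| <
      √3 * P.boxRad b * (1 + tf) + 3 * P.boxRad w := by
    have := dist_triangle (P.boxCtr w) y (P.boxCtr b)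
    have := abs_sub_le_dist (P.boxCtr w) (P.boxCtr b) i
    have := Metric.mem_closedBall.1 hy
    linarith
  have hr := P.boxRad_pos v
  have hT : (0 : ℝ) < 2 ^ m := by positivity
  have h2 : P.boxRad b = 2 ^ m * P.boxRad v := by
    rw [P.boxRad_eq_mul (show b.level ≤ v.level by omega), hvl, Nat.add_sub_cancel_left]
  have h3 : P.boxRad w ≤ P.boxRad v / 2 := by
    rw [← P.boxRad_child v fun _ => false]
    exact P.boxRad_anti hlt
  have h4 : √3 * P.boxRad b * (1 + tf) ≤ (3 * 2 ^ m - 4) * P.boxRad v := by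
    have h5 : √3 * (1 + tf) * 2 ^ m + 4 ≤ 3 * 2 ^ m := by
      have := mul_le_mul_of_nonneg_right hm hT.le
      rwa [add_mul, div_mul_cancel₀ _ hT.ne'] at this
    calc _ = √3 * (1 + tf) * 2 ^ m * P.boxRad v := by rw [h2]; ring
      _ ≤ _ := mul_le_mul_of_nonneg_right (by linarith) hr.le
  obtain ⟨h5, h6⟩ := P.mem_region_iff.1
    (P.region_subset_of_contains hvw.contains (P.boxCtr_mem_region w)) i
  obtain ⟨h7, h8⟩ := abs_lt.1 h1
  rw [P.boxCtr_apply b i, h2] at h7 h8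
  rw [h2] at h4
  constructor
  · have : (2 : ℝ) ^ m * b.idx i < v.idx i + 2 ^ m := by
      refine lt_of_mul_lt_mul_right ?_ hr.le
      linarith
    exact Nat.succ_le_of_lt (by exact_mod_cast this)
  · have : (v.idx i : ℝ) + 1 < 2 ^ m * (b.idx i + 2) := by
      refine lt_of_mul_lt_mul_right ?_ hr.le
      linarith
    exact Nat.succ_le_of_lt (by exact_mod_cast this)

theorem exists_gradation_depth (htf : tf < √3 - 1) :
    ∃ m : ℕ, √3 * (1 + tf) + 4 / 2 ^ m ≤ 3 := by
  have h3 : √3 * √3 = 3 := Real.mul_self_sqrt (by norm_num)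
  have hpos : 0 < 3 - √3 * (1 + tf) := by
    have := mul_lt_mul_of_pos_left (show 1 + tf < √3 by linarith) (show 0 < √3 by positivity)
    linarith
  obtain ⟨m, hm⟩ := exists_pow_lt_of_lt_one (show 0 < (3 - √3 * (1 + tf)) / 4 by linarith)
    (show (1 / 2 : ℝ) < 1 by norm_num)
  refine ⟨m, ?_⟩
  rw [one_div, inv_pow] at hm
  rw [div_eq_mul_inv]
  linarith

/-! ### The shape of List 3 -/

theorem list3Desc_descColleague {b d : Box} (h : d ∈ P.list3Desc tf R b) :
    P.DescColleague tf R b d := by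
  obtain ⟨-, e, he, hed⟩ := Finset.mem_filter.1 h
  exact (Finset.mem_filter.1 he).2.2.1.trans_contains (Box.contains_iff.2 hed)

theorem LevelRestricted.level_le_of_mem_list3 (h : P.LevelRestricted R) {b d : Box}
    (hb : b ∈ allBoxes R \ R) (hd : d ∈ P.list3 tf R b) : d.level ≤ b.level + 1 := by
  obtain ⟨hd, -, hdc, -, hadj⟩ := Finset.mem_filter.1 hd
  obtain ⟨c, hc, hcb, hcd⟩ := hdc
  have hl : 0 < d.level := (Nat.zero_le _).trans_lt hcd.1
  have hpl : d.parent.level = d.level - 1 := rfl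
  obtain ⟨hp, hpR⟩ := parent_mem hd hl
  rcases Box.contains_iff.1 hcd.contains_parent with he | hcp
  · have := hcb.1
    rw [← he] at this
    omega
  · have := h.level_le_of_adjacent hb hpR
      (hadj _ hp (Box.parent_isAncestor hl) ⟨c, hc, hcb, hcp⟩)
    omega

theorem LevelRestricted.level_le_of_mem_list3far (h : P.LevelRestricted R)
    (hR : R ⊆ allBoxes R) {m : ℕ} (hm : √3 * (1 + tf) + 4 / 2 ^ m ≤ 3) {b d : Box}
    (hb : b ∈ allBoxes R \ R) (hd : d ∈ P.list3far tf R b) : d.level ≤ b.level + (m + 1) := by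
  obtain ⟨hd, -, hmax⟩ := Finset.mem_filter.1 hd
  obtain ⟨hdB, e, he, hed⟩ := Finset.mem_filter.1 hd
  rcases hed with rfl | hed
  · have := h.level_le_of_mem_list3 hb he
    omega
  · have hl : 0 < d.level := (Nat.zero_le _).trans_lt hed.1
    have hpl : d.parent.level = d.level - 1 := rfl
    have hp := (parent_mem hdB hl).1
    have hp3 : d.parent ∈ P.list3Desc tf R b :=
      Finset.mem_filter.2 ⟨hp, e, he, Box.contains_iff.1 hed.contains_parent⟩
    have := h.level_le_of_not_sepFromTCR hR hm hb (boxes_subset_allBoxes hp)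
      (hmax _ hp3 (Box.parent_isAncestor hl))
    omega

end

section

variable {P : Input} {tf : ℝ} {nmax : ℕ} {R : Finset Box} {p q : ℕ}

/-! ### Costs of the stages of the evaluation -/

theorem sum_card_children_le :
    ∑ b ∈ P.boxes tf R, (P.children tf R b).card ≤ P.numBoxes tf R := by
  rw [← Finset.card_biUnion]
  · refine Finset.card_le_card (Finset.biUnion_subset.2 fun b _ => Finset.filter_subset _ _)
  · intro a _ b _ hab
    refine Finset.disjoint_left.2 fun d hd hd' => hab ?_
    obtain ⟨-, o, rfl⟩ := Finset.mem_filter.1 hd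
    obtain ⟨-, o', h⟩ := Finset.mem_filter.1 hd'
    simpa using congrArg Box.parent h

theorem cost2_le : P.cost2 tf R p ≤ P.numS * p ^ 2 + P.numBoxes tf R * p ^ 3 := by
  rw [cost2, Finset.sum_add_distrib, ← Finset.sum_mul, ← Finset.sum_mul]
  exact Nat.add_le_add (Nat.mul_le_mul_right _ (sum_nS_le _))
    (Nat.mul_le_mul_right _ sum_card_children_le)

theorem adjacent_of_mem_list1 {b d : Box} (h : d ∈ P.list1 tf R b) : P.Adjacent d b := by
  obtain ⟨-, -, -, rfl | h | h⟩ := Finset.mem_filter.1 h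
  · exact P.adjacent_of_contains (.refl _)
  · exact (P.adjacent_of_contains h.contains).symm
  · exact h

/-- The boxes of List 1 that are smaller than `b`. -/
def list1small (P : Input) (tf : ℝ) (R : Finset Box) (b : Box) : Finset Box :=
  (P.list1 tf R b).filter fun d => b.level < d.level

theorem IsOctree.sum_list1_le (h : P.IsOctree tf nmax R) (b : Box) :
    ∑ d ∈ P.list1 tf R b, P.nS tf R d ≤
      1331 * nmax + ∑ d ∈ P.list1small tf R b, P.nS tf R d := by
  rw [← Finset.sum_filter_not_add_sum_filter (P.list1 tf R b) fun d => b.level < d.level]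
  refine Nat.add_le_add_right (h.sum_nS_le_of_largeNear (m := 5) (b := b) fun d hd => ?_) _
  obtain ⟨hd, hl⟩ := Finset.mem_filter.1 hd
  exact (adjacent_of_mem_list1 hd).largeNear (not_lt.1 hl)

/-- The smaller boxes of List 1 of the unsubdivided boxes. Here each source is charged to the
boundedly many unsubdivided larger boxes that touch its owner. -/
theorem IsOctree.sum_list1small_le (h : P.IsOctree tf nmax R) :
    ∑ b ∈ P.boxes tf R with b ∉ R, ∑ d ∈ P.list1small tf R b, P.nS tf R d ≤
      1331 * P.numS := by
  have hswap : ∑ b ∈ P.boxes tf R with b ∉ R, ∑ d ∈ P.list1small tf R b, P.nS tf R d =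
      ∑ d ∈ P.boxes tf R, ∑ b ∈ (P.boxes tf R).filter
        (fun b => b ∉ R ∧ d ∈ P.list1small tf R b), P.nS tf R d := by
    refine Finset.sum_comm' fun b d => ?_
    simp only [Finset.mem_filter, list1small, list1]
    tauto
  rw [hswap]
  calc _ ≤ ∑ d ∈ P.boxes tf R, 1331 * P.nS tf R d := Finset.sum_le_sum fun d _ => ?_
    _ = 1331 * ∑ d ∈ P.boxes tf R, P.nS tf R d := (Finset.mul_sum _ _ _).symm
    _ ≤ _ := Nat.mul_le_mul_left _ (sum_nS_le _)
  rw [Finset.sum_const, smul_eq_mul]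
  refine Nat.mul_le_mul_right _ (card_largeNear_le h.sub_allBoxes 5 d (fun b hb => ?_)
    fun b hb => ?_)
  · obtain ⟨hb, hbR, -⟩ := Finset.mem_filter.1 hb
    exact Finset.mem_sdiff.2 ⟨boxes_subset_allBoxes hb, hbR⟩
  · obtain ⟨-, -, hd⟩ := Finset.mem_filter.1 hb
    obtain ⟨hd, hl⟩ := Finset.mem_filter.1 hd
    exact (adjacent_of_mem_list1 hd).symm.largeNear hl.le

/-- The sources owned by the boxes of `F`. -/
def sources (P : Input) (tf : ℝ) (R F : Finset Box) : Finset (Fin P.numS) :=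
  Finset.univ.filter fun s => ∃ d ∈ F, P.Owns tf R d (P.ofSrc s)

theorem sources_mem_near {b : Box} {F : Finset Box} (hF : ∀ d ∈ F, P.region d ⊆ P.near 2 b) :
    ∀ s ∈ P.sources tf R F, P.src s ∈ P.near 2 b := by
  intro s hs
  obtain ⟨-, d, hd, hds⟩ := Finset.mem_filter.1 hs
  exact hF d hd hds.1.pos_mem_region

theorem IsOctree.cost3_le (h : P.IsOctree tf nmax R) (htf : 0 < tf) :
    P.cost3 tf R q ≤
      (1331 * nmax * (P.numC + P.numS) + ∑ c, P.nearCount tf c) * q ^ 2 := by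
  have hb : ∀ b, (∑ d ∈ P.list1 tf R b, P.nS tf R d) * P.nC tf R b ≤
      1331 * nmax * P.nC tf R b + P.nearSum tf R b +
        nmax * if b ∉ R then ∑ d ∈ P.list1small tf R b, P.nS tf R d else 0 := by
    intro b
    refine (Nat.mul_le_mul_right _ (h.sum_list1_le b)).trans ?_
    rw [add_mul, add_assoc]
    refine Nat.add_le_add_left ?_ _
    rcases h.suspended_or b with hs | ⟨hbR, hn⟩
    · refine le_trans ?_ (Nat.le_add_right _ _)
      refine (Nat.mul_le_mul_right _ (sum_nS_le_card _)).trans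
        (hs.card_mul_nC_le htf (sources_mem_near fun d hd => ?_))
      obtain ⟨hd, hl⟩ := Finset.mem_filter.1 hd
      exact (adjacent_of_mem_list1 hd).region_subset_near hl.le
    · rw [if_pos hbR, mul_comm]
      exact (Nat.mul_le_mul_right _ hn).trans (Nat.le_add_left _ _)
  simp only [cost3, ← Finset.sum_mul]
  refine Nat.mul_le_mul_right _ ((Finset.sum_le_sum fun b _ => hb b).trans ?_)
  rw [Finset.sum_add_distrib, Finset.sum_add_distrib, ← Finset.mul_sum, ← Finset.mul_sum,
    ← Finset.sum_filter]
  have h1 := Nat.mul_le_mul_left (1331 * nmax) (sum_nC_le (P := P) (tf := tf) (R := R)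
    (P.boxes tf R))
  have h2 := sum_nearSum_le (P := P) (tf := tf) (R := R) (P.boxes tf R)
  have h3 := Nat.mul_le_mul_left nmax h.sum_list1small_le
  linarith

theorem card_list2_le (b : Box) : (P.list2 tf R b).card ≤ 1000 := by
  refine (Finset.card_le_card fun d hd => ?_).trans
    (card_window_le (b.parent.level + 1) (fun i => 2 * (b.parent.idx i - 2)) 10)
  obtain ⟨-, -, -, ⟨e, -, he, hde⟩, -⟩ := Finset.mem_filter.1 hd
  obtain ⟨-, o, rfl⟩ := Finset.mem_filter.1 hde
  refine mem_window (congrArg Nat.succ he.1) fun i => ?_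
  have h1 := he.idx i
  have h2 : (o i).toNat < 2 := Bool.toNat_lt _
  simp only [Box.child]
  omega

theorem cost4_le : P.cost4 tf R p ≤ 1000 * P.numBoxes tf R * p ^ 3 := by
  rw [cost4, ← Finset.sum_mul]
  refine Nat.mul_le_mul_right _ ((Finset.sum_le_card_nsmul _ _ 1000 fun b _ =>
    card_list2_le b).trans_eq ?_)
  simp [numBoxes, mul_comm]

/-- The boxes below the `2`-colleagues of `b`. -/
def descColleagues (P : Input) (tf : ℝ) (R : Finset Box) (b : Box) : Finset Box :=
  (P.boxes tf R).filter fun d => P.DescColleague tf R b d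

theorem sum_list3close_le (b : Box) :
    ∑ d ∈ P.list3close tf R b, P.nS tf R d ≤
      ∑ d ∈ P.descColleagues tf R b, P.nS tf R d := by
  refine Finset.sum_le_sum_of_subset fun d hd => ?_
  have hd := (Finset.mem_filter.1 hd).1
  exact Finset.mem_filter.2 ⟨(Finset.mem_filter.1 hd).1, list3Desc_descColleague hd⟩

/-- The boxes of List 3 far are disjoint by maximality, so no leaf is counted twice. -/
theorem sum_leafSources_le (b : Box) :
    ∑ d ∈ P.list3far tf R b, P.leafSources tf R d ≤
      ∑ d ∈ P.descColleagues tf R b, P.nS tf R d := by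
  simp only [leafSources]
  rw [← Finset.sum_biUnion]
  · refine Finset.sum_le_sum_of_subset fun e he => ?_
    obtain ⟨d, hd, he⟩ := Finset.mem_biUnion.1 he
    obtain ⟨heB, -, hed⟩ := Finset.mem_filter.1 he
    exact Finset.mem_filter.2 ⟨heB, (list3Desc_descColleague
      (Finset.mem_filter.1 hd).1).trans_contains (Box.contains_iff.2 hed)⟩
  · intro d hd d' hd' hne
    obtain ⟨hd, hs, hmax⟩ := Finset.mem_filter.1 hd
    obtain ⟨hd', hs', hmax'⟩ := Finset.mem_filter.1 hd'
    refine Finset.disjoint_left.2 fun e he he' => hne ?_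
    have hc := Box.contains_iff.2 (Finset.mem_filter.1 he).2.2
    have hc' := Box.contains_iff.2 (Finset.mem_filter.1 he').2.2
    rcases le_total d.level d'.level with hl | hl
    · rcases Box.contains_iff.1 (hc.of_contains hc' hl) with h | h
      · exact h.symm
      · exact absurd hs (hmax' d hd h)
    · rcases Box.contains_iff.1 (hc'.of_contains hc hl) with h | h
      · exact h
      · exact absurd hs' (hmax d' hd' h)

theorem Suspended.sum_descColleagues_le (htf : 0 < tf) {b : Box}
    (hb : P.Suspended tf R b) :
    (∑ d ∈ P.descColleagues tf R b, P.nS tf R d) * P.nC tf R b ≤ P.nearSum tf R b :=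
  (Nat.mul_le_mul_right _ (sum_nS_le_card _)).trans
    (hb.card_mul_nC_le htf (sources_mem_near fun _ hd =>
      (Finset.mem_filter.1 hd).2.region_subset_near))

theorem sum_descColleagues_le :
    ∑ b ∈ P.boxes tf R, ∑ d ∈ P.descColleagues tf R b, P.nS tf R d ≤
      125 * P.numLevels tf R * P.numS := by
  have hswap : ∑ b ∈ P.boxes tf R, ∑ d ∈ P.descColleagues tf R b, P.nS tf R d =
      ∑ d ∈ P.boxes tf R, ∑ b ∈ (P.boxes tf R).filter
        (fun b => P.DescColleague tf R b d), P.nS tf R d := by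
    refine Finset.sum_comm' fun b d => ?_
    simp only [Finset.mem_filter, descColleagues]
    tauto
  rw [hswap]
  calc _ ≤ ∑ d ∈ P.boxes tf R, 125 * P.numLevels tf R * P.nS tf R d :=
        Finset.sum_le_sum fun d _ => ?_
    _ = 125 * P.numLevels tf R * ∑ d ∈ P.boxes tf R, P.nS tf R d := (Finset.mul_sum _ _ _).symm
    _ ≤ _ := Nat.mul_le_mul_left _ (sum_nS_le _)
  rw [Finset.sum_const, smul_eq_mul]
  exact Nat.mul_le_mul_right _ (card_filter_descColleague_le d)

/-- The List 3 interactions of one box, all replaced by direct ones. -/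
theorem list3_cost_le_direct (b : Box) :
    ∑ d ∈ P.list3close tf R b, P.nS tf R d * P.nC tf R b * q ^ 2 +
      ∑ d ∈ P.list3far tf R b,
        min (P.nC tf R b * p ^ 3) (P.leafSources tf R d * P.nC tf R b * q ^ 2) ≤
      2 * ((∑ d ∈ P.descColleagues tf R b, P.nS tf R d) * P.nC tf R b) * q ^ 2 := by
  have h1 : ∑ d ∈ P.list3close tf R b, P.nS tf R d * P.nC tf R b * q ^ 2 ≤
      (∑ d ∈ P.descColleagues tf R b, P.nS tf R d) * P.nC tf R b * q ^ 2 := by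
    simp only [← Finset.sum_mul]
    exact Nat.mul_le_mul_right _ (Nat.mul_le_mul_right _ (sum_list3close_le b))
  have h2 : ∑ d ∈ P.list3far tf R b,
        min (P.nC tf R b * p ^ 3) (P.leafSources tf R d * P.nC tf R b * q ^ 2) ≤
      (∑ d ∈ P.descColleagues tf R b, P.nS tf R d) * P.nC tf R b * q ^ 2 := by
    refine (Finset.sum_le_sum fun d _ => min_le_right _ _).trans ?_
    simp only [← Finset.sum_mul]
    exact Nat.mul_le_mul_right _ (Nat.mul_le_mul_right _ (sum_leafSources_le b))
  linarith

theorem IsOctree.cost5_le (h : P.IsOctree tf nmax R) (htf : 0 < tf) :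
    P.cost5 tf R p q ≤
      2 * (∑ c, P.nearCount tf c + nmax * (125 * P.numLevels tf R * P.numS)) * q ^ 2 := by
  refine (Finset.sum_le_sum fun b _ => list3_cost_le_direct b).trans ?_
  rw [← Finset.sum_mul, ← Finset.mul_sum]
  refine Nat.mul_le_mul_right _ (Nat.mul_le_mul_left _ ?_)
  calc _ ≤ ∑ b ∈ P.boxes tf R,
        (P.nearSum tf R b + nmax * ∑ d ∈ P.descColleagues tf R b, P.nS tf R d) :=
        Finset.sum_le_sum fun b _ => ?_
    _ = ∑ b ∈ P.boxes tf R, P.nearSum tf R b +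
        nmax * ∑ b ∈ P.boxes tf R, ∑ d ∈ P.descColleagues tf R b, P.nS tf R d := by
        rw [Finset.sum_add_distrib, ← Finset.mul_sum]
    _ ≤ _ := Nat.add_le_add (sum_nearSum_le _)
        (Nat.mul_le_mul_left _ sum_descColleagues_le)
  rcases h.suspended_or b with hs | ⟨-, hn⟩
  · exact (hs.sum_descColleagues_le htf).trans (Nat.le_add_right _ _)
  · rw [mul_comm]
    exact (Nat.mul_le_mul_right _ hn).trans (Nat.le_add_left _ _)

/-- In a level-restricted tree the List 3 close and List 3 far of an unsubdivided box are bounded,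
and only the boxes in which all centers are kept need a charge to their neighborhoods. -/
theorem IsOctree.cost5_le_of_levelRestricted (h : P.IsOctree tf nmax R)
    (hres : P.LevelRestricted R) (htf : 0 < tf) {m : ℕ}
    (hm : √3 * (1 + tf) + 4 / 2 ^ m ≤ 3) :
    P.cost5 tf R p q ≤ 2 * (∑ c, P.nearCount tf c) * q ^ 2 +
      P.numC * ((m + 2) * (5 * 2 ^ (m + 1)) ^ 3 * (nmax * q ^ 2 + p ^ 3)) := by
  set D := (m + 2) * (5 * 2 ^ (m + 1)) ^ 3
  calc _ ≤ ∑ b ∈ P.boxes tf R, (2 * P.nearSum tf R b * q ^ 2 +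
        P.nC tf R b * (D * (nmax * q ^ 2 + p ^ 3))) := Finset.sum_le_sum fun b hb => ?_
    _ = 2 * (∑ b ∈ P.boxes tf R, P.nearSum tf R b) * q ^ 2 +
        (∑ b ∈ P.boxes tf R, P.nC tf R b) * (D * (nmax * q ^ 2 + p ^ 3)) := by
        rw [Finset.sum_add_distrib, ← Finset.sum_mul, ← Finset.sum_mul, ← Finset.mul_sum]
    _ ≤ _ := Nat.add_le_add
        (Nat.mul_le_mul_right _ (Nat.mul_le_mul_left _ (sum_nearSum_le _)))
        (Nat.mul_le_mul_right _ (sum_nC_le _))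
  rcases h.suspended_or b with hs | ⟨hbR, -⟩
  · refine (list3_cost_le_direct b).trans (le_trans ?_ (Nat.le_add_right _ _))
    exact Nat.mul_le_mul_right _ (Nat.mul_le_mul_left _ (hs.sum_descColleagues_le htf))
  · refine le_trans ?_ (Nat.le_add_left _ _)
    have hb' : b ∈ allBoxes R \ R := Finset.mem_sdiff.2 ⟨boxes_subset_allBoxes hb, hbR⟩
    have hclose : (P.list3close tf R b).card ≤ D := card_le_of_descColleague fun d hd => by
      obtain ⟨hd, -, hsep⟩ := Finset.mem_filter.1 hd
      have := hres.level_le_of_not_sepFromTCR h.sub_allBoxes hm hb'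
        (boxes_subset_allBoxes (Finset.mem_filter.1 hd).1) hsep
      exact ⟨list3Desc_descColleague hd, this.trans (by omega)⟩
    have hfar : (P.list3far tf R b).card ≤ D := card_le_of_descColleague fun d hd =>
      ⟨list3Desc_descColleague (Finset.mem_filter.1 hd).1,
        hres.level_le_of_mem_list3far h.sub_allBoxes hm hb' hd⟩
    have h1 : ∑ d ∈ P.list3close tf R b, P.nS tf R d * P.nC tf R b * q ^ 2 ≤
        D * (nmax * P.nC tf R b * q ^ 2) :=
      (Finset.sum_le_card_nsmul _ _ _ fun d _ => Nat.mul_le_mul_right _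
        (Nat.mul_le_mul_right _ (h.nS_le d))).trans (Nat.mul_le_mul_right _ hclose)
    have h2 : ∑ d ∈ P.list3far tf R b,
        min (P.nC tf R b * p ^ 3) (P.leafSources tf R d * P.nC tf R b * q ^ 2) ≤
        D * (P.nC tf R b * p ^ 3) :=
      (Finset.sum_le_card_nsmul _ _ _ fun d _ => min_le_left _ _).trans
        (Nat.mul_le_mul_right _ hfar)
    calc _ ≤ _ := Nat.add_le_add h1 h2
      _ = _ := by ring

theorem level_le_of_mem_list4 {b d : Box} (h : d ∈ P.list4 tf R b) : d.level ≤ b.level := by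
  obtain ⟨-, -, -, ⟨⟨a, -, hab, hda⟩, -⟩ | ⟨hdb, -⟩⟩ := Finset.mem_filter.1 h
  · exact hda.1.trans_le hab.1.le
  · exact hdb.1.le

theorem largeNear_of_mem_list4 {b d : Box} (h : d ∈ P.list4 tf R b) :
    d.LargeNear 5 b ∨ d.LargeNear 5 b.parent := by
  obtain ⟨-, -, -, ⟨⟨a, -, hab, hda⟩, hp, -⟩ | ⟨hdb, -⟩⟩ := Finset.mem_filter.1 h
  · refine Or.inr (hp.largeNear ?_)
    rw [hda.1]
    exact hab.contains_parent.1
  · refine Or.inl ⟨d, hdb.1, .refl d, fun i => ?_⟩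
    have := hdb.idx i
    omega

theorem largeNear_of_mem_list4close (htf : tf < 2) {b d : Box}
    (h : d ∈ P.list4close tf R b) : d.LargeNear 5 b := by
  obtain ⟨-, -, ⟨w, -, hw, hd⟩, hsep⟩ := Finset.mem_filter.1 h
  have hwb : w.Contains b := by
    rcases hw with rfl | hw
    · exact .refl _
    · exact hw.contains
  simp only [TCRSepFrom, not_forall, not_exists, not_le] at hsep
  obtain ⟨y, hy, hyb⟩ := hsep
  refine P.largeNear_of_mem ((level_le_of_mem_list4 hd).trans hwb.1) hy fun i =>
    (hyb i).le.trans ?_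
  have := mul_le_mul_of_nonneg_left (show 1 + tf ≤ 3 by linarith)
    (show 0 ≤ 3 * P.boxRad b by have := P.boxRad_pos b; positivity)
  linarith

theorem IsOctree.sum_list4far_le (h : P.IsOctree tf nmax R) (htf : tf < 2) (b : Box) :
    ∑ d ∈ P.list4far tf R b, P.nS tf R d ≤ 2662 * nmax := by
  rw [← Finset.sum_filter_add_sum_filter_not (P.list4far tf R b) fun d => d.LargeNear 5 b]
  have h1 := h.sum_nS_le_of_largeNear (m := 5) (b := b)
    (F := (P.list4far tf R b).filter fun d => d.LargeNear 5 b)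
    fun d hd => (Finset.mem_filter.1 hd).2
  have h2 := h.sum_nS_le_of_largeNear (m := 5) (b := b.parent)
    (F := (P.list4far tf R b).filter fun d => ¬ d.LargeNear 5 b) fun d hd => by
      obtain ⟨hd, hn⟩ := Finset.mem_filter.1 hd
      obtain ⟨-, -, -, hd | ⟨-, hd⟩⟩ := Finset.mem_filter.1 hd
      · exact (largeNear_of_mem_list4 hd).resolve_left hn
      · exact largeNear_of_mem_list4close htf hd
  omega

theorem IsOctree.cost6_le (h : P.IsOctree tf nmax R) (htf : tf < 2) :
    P.cost6 tf R p q ≤ 1331 * nmax * P.numC * q ^ 2 +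
      2662 * nmax * P.numBoxes tf R * p ^ 2 := by
  have h1 : ∀ b, ∑ d ∈ P.list4close tf R b, P.nS tf R d ≤ 1331 * nmax := fun b =>
    h.sum_nS_le_of_largeNear (m := 5) (b := b) fun d hd => largeNear_of_mem_list4close htf hd
  rw [cost6]
  simp only [← Finset.sum_mul]
  rw [Finset.sum_add_distrib, ← Finset.sum_mul, ← Finset.sum_mul]
  refine Nat.add_le_add (Nat.mul_le_mul_right _ ?_) (Nat.mul_le_mul_right _ ?_)
  · refine (Finset.sum_le_sum fun b _ => Nat.mul_le_mul_right _ (h1 b)).trans ?_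
    rw [← Finset.mul_sum]
    exact Nat.mul_le_mul_left _ (sum_nC_le _)
  · refine (Finset.sum_le_card_nsmul _ _ _ fun b _ => h.sum_list4far_le htf b).trans_eq ?_
    rw [smul_eq_mul, mul_comm]
    rfl

theorem cost7_le : P.cost7 tf R p ≤ P.numBoxes tf R * p ^ 3 := by
  rw [cost7, ← Finset.sum_mul]
  exact Nat.mul_le_mul_right _ sum_card_children_le

theorem cost8_le : P.cost8 tf R p ≤ P.numC * p ^ 3 := by
  rw [cost8, ← Finset.sum_mul]
  exact Nat.mul_le_mul_right _ (sum_nC_le _)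

theorem cost9_le : P.cost9 tf R q ≤ P.numT * q ^ 2 := by
  rw [cost9, ← Finset.sum_mul]
  exact Nat.mul_le_mul_right _ ((sum_card_owns_le _ fun t => P.ofCtr (P.assoc t)).trans
    ((Finset.card_le_univ _).trans_eq (Fintype.card_fin _)))

end

section

variable {P : Input} {tf : ℝ} {nmax : ℕ} {R : Finset Box} {p q : ℕ}

/-! ### Total cost of the evaluation -/

theorem sq_le_pow_three (p : ℕ) : p ^ 2 ≤ p ^ 3 := by
  rcases Nat.eq_zero_or_pos p with rfl | h
  · simp
  · exact Nat.pow_le_pow_right h (by norm_num)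

/-- All stages except List 3. -/
theorem IsOctree.evalCost_le_add_cost5 (h : P.IsOctree tf nmax R) (htf : 0 < tf) (htf' : tf < 2)
    (hqp : q ≤ p) :
    P.evalCost tf R p q ≤
      (1003 + 5324 * nmax) * ((P.numC + P.numS + P.numBoxes tf R) * p ^ 3) +
        (∑ c, P.nearCount tf c) * p ^ 2 + P.numT * p ^ 2 + P.cost5 tf R p q := by
  have hq : q ^ 2 ≤ p ^ 2 := Nat.pow_le_pow_left hqp 2
  have hp := sq_le_pow_three p
  set W := P.numC + P.numS + P.numBoxes tf R with hW
  have h2 : P.cost2 tf R p ≤ (P.numS + P.numBoxes tf R) * p ^ 3 := by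
    refine cost2_le.trans ?_
    rw [add_mul]
    gcongr
  have h3 : P.cost3 tf R q ≤ 1331 * nmax * (W * p ^ 3) + (∑ c, P.nearCount tf c) * p ^ 2 := by
    refine (h.cost3_le htf).trans ?_
    rw [add_mul, ← mul_assoc]
    gcongr 1331 * nmax * ?_ * ?_ + _ * ?_
    · omega
    · exact hq.trans hp
  have h4 : P.cost4 tf R p ≤ 1000 * (W * p ^ 3) := by
    refine cost4_le.trans ?_
    rw [mul_assoc]
    gcongr
    omega
  have h6 : P.cost6 tf R p q ≤ 3993 * nmax * (W * p ^ 3) := by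
    calc _ ≤ 1331 * nmax * P.numC * q ^ 2 + 2662 * nmax * P.numBoxes tf R * p ^ 2 :=
          h.cost6_le htf'
      _ ≤ 1331 * nmax * W * p ^ 3 + 2662 * nmax * W * p ^ 3 := by
          gcongr 1331 * nmax * ?_ * ?_ + 2662 * nmax * ?_ * ?_
          · omega
          · exact hq.trans hp
          · omega
      _ = _ := by ring
  have h7 := cost7_le (P := P) (tf := tf) (R := R) (p := p)
  have h8 := cost8_le (P := P) (tf := tf) (R := R) (p := p)
  have h9 : P.cost9 tf R q ≤ P.numT * p ^ 2 := cost9_le.trans (Nat.mul_le_mul_left _ hq)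
  have h10 : W * p ^ 3 = P.numC * p ^ 3 + P.numS * p ^ 3 + P.numBoxes tf R * p ^ 3 := by
    rw [hW]; ring
  have h11 : (1003 + 5324 * nmax) * (W * p ^ 3) = 1003 * (W * p ^ 3) +
      1331 * nmax * (W * p ^ 3) + 3993 * nmax * (W * p ^ 3) := by ring
  rw [evalCost, h11]
  linarith [Nat.zero_le (P.numC * p ^ 3), Nat.zero_le (P.numS * p ^ 3),
    Nat.zero_le (P.numBoxes tf R * p ^ 3)]

theorem IsOctree.evalCost_le (h : P.IsOctree tf nmax R) (htf : 0 < tf) (htf' : tf < 2)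
    (hqp : q ≤ p) :
    P.evalCost tf R p q ≤ (1003 + 5324 * nmax) *
      ((P.numC + P.numS + P.numBoxes tf R) * p ^ 3 +
        (∑ c, P.nearCount tf c + P.numParticles * P.numLevels tf R) * p ^ 2 +
        P.numT * p ^ 2) := by
  have hq : q ^ 2 ≤ p ^ 2 := Nat.pow_le_pow_left hqp 2
  have h5 : P.cost5 tf R p q ≤ 2 * ((∑ c, P.nearCount tf c) * p ^ 2) +
      250 * nmax * (P.numParticles * P.numLevels tf R * p ^ 2) := by
    calc _ ≤ 2 * (∑ c, P.nearCount tf c + nmax * (125 * P.numLevels tf R * P.numS)) * q ^ 2 :=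
          h.cost5_le htf
      _ ≤ 2 * (∑ c, P.nearCount tf c + nmax * (125 * P.numLevels tf R * P.numParticles)) *
          p ^ 2 := by
          gcongr
          rw [numParticles]
          omega
      _ = _ := by ring
  have h0 := h.evalCost_le_add_cost5 htf htf' hqp
  generalize (P.numC + P.numS + P.numBoxes tf R) * p ^ 3 = a at *
  rw [add_mul (∑ c, P.nearCount tf c)]
  generalize (∑ c, P.nearCount tf c) * p ^ 2 = x at *
  generalize P.numParticles * P.numLevels tf R * p ^ 2 = y at *
  nlinarith [Nat.zero_le (nmax * x), Nat.zero_le (nmax * y), Nat.zero_le (nmax * (P.numT * p ^ 2)),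
    Nat.zero_le (P.numT * p ^ 2)]

theorem IsOctree.evalCost_le_of_levelRestricted (h : P.IsOctree tf nmax R)
    (hres : P.LevelRestricted R) (htf : 0 < tf) (htf' : tf < 2) {m : ℕ}
    (hm : √3 * (1 + tf) + 4 / 2 ^ m ≤ 3) (hqp : q ≤ p) :
    P.evalCost tf R p q ≤
      (1003 + 5324 * nmax + (m + 2) * (5 * 2 ^ (m + 1)) ^ 3 * (nmax + 1)) *
      ((P.numC + P.numS + P.numBoxes tf R) * p ^ 3 +
        (∑ c, P.nearCount tf c) * p ^ 2 + P.numT * p ^ 2) := by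
  have hq : q ^ 2 ≤ p ^ 2 := Nat.pow_le_pow_left hqp 2
  have hp := sq_le_pow_three p
  set D := (m + 2) * (5 * 2 ^ (m + 1)) ^ 3
  have h5 : P.cost5 tf R p q ≤ 2 * ((∑ c, P.nearCount tf c) * p ^ 2) +
      D * (nmax + 1) * ((P.numC + P.numS + P.numBoxes tf R) * p ^ 3) := by
    calc _ ≤ 2 * (∑ c, P.nearCount tf c) * q ^ 2 +
          P.numC * (D * (nmax * q ^ 2 + p ^ 3)) :=
          h.cost5_le_of_levelRestricted hres htf hm
      _ ≤ 2 * (∑ c, P.nearCount tf c) * p ^ 2 +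
          (P.numC + P.numS + P.numBoxes tf R) * (D * (nmax * p ^ 3 + p ^ 3)) := by
          gcongr 2 * _ * ?_ + ?_ * (D * (nmax * ?_ + _))
          · omega
          · exact hq.trans hp
      _ = _ := by ring
  have h0 := h.evalCost_le_add_cost5 htf htf' hqp
  generalize (P.numC + P.numS + P.numBoxes tf R) * p ^ 3 = a at *
  generalize (∑ c, P.nearCount tf c) * p ^ 2 = x at *
  generalize D * (nmax + 1) = e at *
  nlinarith [Nat.zero_le (nmax * x), Nat.zero_le (e * x), Nat.zero_le (e * (P.numT * p ^ 2)),
    Nat.zero_le (nmax * (P.numT * p ^ 2)), Nat.zero_le (P.numT * p ^ 2)]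

/-- From powers of the order `p` to powers of `|log ε|`. -/
theorem mul_pow_le_of_le_mul {K A l a b c : ℝ} {p : ℕ} (hK : 0 ≤ K) (ha : 0 ≤ a) (hb : 0 ≤ b)
    (hc : 0 ≤ c) (hl : 0 ≤ l) (hp : (p : ℝ) ≤ A * l) :
    K * (a * (p : ℝ) ^ 3 + b * (p : ℝ) ^ 2 + c * (p : ℝ) ^ 2) ≤
      K * (max 1 A) ^ 3 * (a * l ^ 3 + b * l ^ 2 + c * l ^ 2) := by
  have hB : 1 ≤ max 1 A := le_max_left _ _
  have hp' : (p : ℝ) ≤ max 1 A * l :=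
    hp.trans (mul_le_mul_of_nonneg_right (le_max_right _ _) hl)
  have h3 : (p : ℝ) ^ 3 ≤ (max 1 A) ^ 3 * l ^ 3 := by
    rw [← mul_pow]
    exact pow_le_pow_left₀ p.cast_nonneg hp' 3
  have h2 : (p : ℝ) ^ 2 ≤ (max 1 A) ^ 3 * l ^ 2 := by
    calc (p : ℝ) ^ 2 ≤ (max 1 A * l) ^ 2 := pow_le_pow_left₀ p.cast_nonneg hp' 2
      _ = (max 1 A) ^ 2 * l ^ 2 := mul_pow _ _ _
      _ ≤ _ := mul_le_mul_of_nonneg_right (pow_le_pow_right₀ hB (by norm_num)) (sq_nonneg l)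
  calc _ ≤ K * (a * ((max 1 A) ^ 3 * l ^ 3) + b * ((max 1 A) ^ 3 * l ^ 2) +
        c * ((max 1 A) ^ 3 * l ^ 2)) := by gcongr
    _ = _ := by ring

theorem exists_evalCost_le (nmax : ℕ) (A : ℝ) : ∃ C : ℝ, ∀ tf : ℝ, 0 < tf → tf < 2 →
    ∀ (P : Input) (R : Finset Box), P.IsOctree tf nmax R →
    ∀ (p q : ℕ) (ε : ℝ), q ≤ p → 0 < ε → ε < 1 → (p : ℝ) ≤ A * |Real.log ε| →
      (P.evalCost tf R p q : ℝ) ≤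
        C * ((P.numC + P.numS + P.numBoxes tf R) * |Real.log ε| ^ 3
          + (P.numC * P.avgNear tf + P.numParticles * P.numLevels tf R) * |Real.log ε| ^ 2
          + P.numT * |Real.log ε| ^ 2) := by
  refine ⟨(1003 + 5324 * nmax) * (max 1 A) ^ 3, fun tf htf htf' P R h p q ε hqp _ _ hp => ?_⟩
  have h1 := Nat.cast_le (α := ℝ).2 (h.evalCost_le htf htf' hqp)
  rw [numC_mul_avgNear]
  refine le_trans ?_ (mul_pow_le_of_le_mul (by positivity) (by positivity) (by positivity)
    (by positivity) (abs_nonneg _) hp)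
  push_cast at h1 ⊢
  exact h1

theorem exists_evalCost_le_of_levelRestricted (nmax : ℕ) (A tf : ℝ) (htf : 0 < tf)
    (htf' : tf < √3 - 1) : ∃ C : ℝ, 0 ≤ C ∧
    ∀ (P : Input) (R : Finset Box), P.IsOctree tf nmax R → P.LevelRestricted R →
    ∀ (p q : ℕ) (ε : ℝ), q ≤ p → 0 < ε → ε < 1 → (p : ℝ) ≤ A * |Real.log ε| →
      (P.evalCost tf R p q : ℝ) ≤
        C * ((P.numC + P.numS + P.numBoxes tf R) * |Real.log ε| ^ 3
          + P.numC * P.avgNear tf * |Real.log ε| ^ 2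
          + P.numT * |Real.log ε| ^ 2) := by
  obtain ⟨m, hm⟩ := exists_gradation_depth htf'
  have h3 : √3 ≤ 2 := Real.sqrt_le_iff.2 ⟨by norm_num, by norm_num⟩
  refine ⟨((1003 + 5324 * nmax + (m + 2) * (5 * 2 ^ (m + 1)) ^ 3 * (nmax + 1) : ℕ) : ℝ) *
    (max 1 A) ^ 3, by positivity, fun P R h hres p q ε hqp _ _ hp => ?_⟩
  have h1 := Nat.cast_le (α := ℝ).2
    (h.evalCost_le_of_levelRestricted hres htf (by linarith) hm hqp)
  rw [numC_mul_avgNear]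
  refine le_trans ?_ (mul_pow_le_of_le_mul (by positivity) (by positivity) (by positivity)
    (by positivity) (abs_nonneg _) hp)
  push_cast at h1 ⊢
  exact h1

theorem exists_evalCost_le_mul_numParticles (nmax : ℕ) (A tf : ℝ) (htf : 0 < tf)
    (htf' : tf < √3 - 1) (K M ε : ℝ) (hε : 0 < ε) (hε' : ε < 1) : ∃ C : ℝ,
    ∀ (P : Input) (R : Finset Box), P.IsOctree tf nmax R → P.LevelRestricted R →
    (P.numBoxes tf R : ℝ) ≤ K * P.numParticles → P.avgNear tf ≤ M →
    ∀ p q : ℕ, q ≤ p → (p : ℝ) ≤ A * |Real.log ε| →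
      (P.evalCost tf R p q : ℝ) ≤ C * P.numParticles := by
  obtain ⟨C, hC, hmain⟩ := exists_evalCost_le_of_levelRestricted nmax A tf htf htf'
  set l := |Real.log ε|
  refine ⟨C * ((1 + K) * l ^ 3 + |M| * l ^ 2 + l ^ 2),
    fun P R h hres hK hM p q hqp hp => ?_⟩
  have hN : (P.numParticles : ℝ) = P.numS + P.numC + P.numT := by
    simp [numParticles]
  have h1 : (P.numC + P.numS + P.numBoxes tf R : ℝ) ≤ (1 + K) * P.numParticles := by
    have : (0 : ℝ) ≤ P.numT := by positivity
    linarith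
  have h2 : (P.numC : ℝ) * P.avgNear tf ≤ |M| * P.numParticles := by
    have h3 : (P.numC : ℝ) ≤ P.numParticles := by
      rw [hN]
      have : (0 : ℝ) ≤ P.numS := by positivity
      have : (0 : ℝ) ≤ P.numT := by positivity
      linarith
    calc _ ≤ (P.numC : ℝ) * |M| :=
          mul_le_mul_of_nonneg_left (hM.trans (le_abs_self M)) (by positivity)
      _ ≤ P.numParticles * |M| := mul_le_mul_of_nonneg_right h3 (abs_nonneg M)
      _ = _ := mul_comm _ _
  have h4 : (P.numT : ℝ) ≤ P.numParticles := by
    rw [hN]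
    have : (0 : ℝ) ≤ P.numS := by positivity
    have : (0 : ℝ) ≤ P.numC := by positivity
    linarith
  calc _ ≤ _ := hmain P R h hres p q ε hqp hε hε' hp
    _ ≤ C * ((1 + K) * P.numParticles * l ^ 3 + |M| * P.numParticles * l ^ 2 +
        P.numParticles * l ^ 2) := by gcongr
    _ = _ := by ring

end

end Input

end

end Gigaqbx

theorem theorem2 :
    -- the tree build
    (∃ C : ℝ, ∀ (nmax : ℕ) (tf : ℝ), 0 ≤ tf → tf < 2 →
      ∀ P : Gigaqbx.Input, P.BuildTerminates tf nmax →
        (P.buildCost tf nmax : ℝ) ≤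
          C * (P.numParticles * P.numLevels tf (P.buildTree tf nmax))) ∧
    -- the evaluation stage, general octree
    (∀ (nmax : ℕ) (A : ℝ), ∃ C : ℝ, ∀ tf : ℝ, 0 < tf → tf < 2 →
      ∀ (P : Gigaqbx.Input) (R : Finset Gigaqbx.Box), P.IsOctree tf nmax R →
      ∀ (p q : ℕ) (ε : ℝ), q ≤ p → 0 < ε → ε < 1 → (p : ℝ) ≤ A * |Real.log ε| →
        (P.evalCost tf R p q : ℝ) ≤
          C * ((P.numC + P.numS + P.numBoxes tf R) * |Real.log ε| ^ 3
            + (P.numC * P.avgNear tf + P.numParticles * P.numLevels tf R) * |Real.log ε| ^ 2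
            + P.numT * |Real.log ε| ^ 2)) ∧
    -- the evaluation stage, level-restricted octree
    (∀ (nmax : ℕ) (A tf : ℝ), 0 < tf → tf < √3 - 1 → ∃ C : ℝ,
      ∀ (P : Gigaqbx.Input) (R : Finset Gigaqbx.Box), P.IsOctree tf nmax R →
      P.LevelRestricted R →
      ∀ (p q : ℕ) (ε : ℝ), q ≤ p → 0 < ε → ε < 1 → (p : ℝ) ≤ A * |Real.log ε| →
        (P.evalCost tf R p q : ℝ) ≤
          C * ((P.numC + P.numS + P.numBoxes tf R) * |Real.log ε| ^ 3
            + P.numC * P.avgNear tf * |Real.log ε| ^ 2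
            + P.numT * |Real.log ε| ^ 2)) ∧
    -- linear cost for families of inputs with bounded `N_B / N` and `M_C`
    (∀ (nmax : ℕ) (A tf : ℝ), 0 < tf → tf < √3 - 1 →
      ∀ (K M ε : ℝ), 0 < ε → ε < 1 → ∃ C : ℝ,
      ∀ (P : Gigaqbx.Input) (R : Finset Gigaqbx.Box), P.IsOctree tf nmax R →
      P.LevelRestricted R →
      (P.numBoxes tf R : ℝ) ≤ K * P.numParticles → P.avgNear tf ≤ M →
      ∀ p q : ℕ, q ≤ p → (p : ℝ) ≤ A * |Real.log ε| →
        (P.evalCost tf R p q : ℝ) ≤ C * P.numParticles) := by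
  exact ⟨⟨9, fun nmax tf _ _ P _ => by exact_mod_cast P.buildCost_le⟩,
    Gigaqbx.Input.exists_evalCost_le,
    fun nmax A tf htf htf' =>
      let ⟨C, _, h⟩ := Gigaqbx.Input.exists_evalCost_le_of_levelRestricted nmax A tf htf htf'
      ⟨C, h⟩,
    Gigaqbx.Input.exists_evalCost_le_mul_numParticles⟩
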